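/- Let $r\ge 1$. The $A_r$ $Q$-system for a family $(R_{\alpha,n})_{0\le\alpha\le r+1,\ n\in\mathbb Z}$ of elements of a field consists of the relations $$R_{\alpha,n+1}R_{\alpha,n-1}=R_{\alpha,n}^2+R_{\alpha+1,n}R_{\alpha-1,n}\qquad(1\le\alpha\le r,\ n\in\mathbb Z),\qquad R_{0,n}=R_{r+1,n}=1\quad(n\in\mathbb Z),$$ and its initial data are $\mathbf x_0=(R_{\alpha,0},R_{\alpha,1})_{1\le\alpha\le r}$. A solution is called non-vanishing if $R_{\alpha,n}\neq0$ for all $1\le\alpha\le r$, $n\in\mathbb Z$. Put $$y_{2\alpha-1}=\frac{R_{\alpha-1,0}R_{\alpha,1}}{R_{\alpha,0}R_{\alpha-1,1}}\ (1\le\alpha\le r+1),\qquad y_{2\alpha}=\frac{R_{\alpha-1,0}R_{\alpha+1,1}}{R_{\alpha,0}R_{\alpha,1}}\ (1\le\alpha\le r).$$ Let $\widetilde G_r$ be the graph with the $2r+2$ vertices $0,1,\dots,r+2$ and $2',3',\dots,r'$, and with the following edges, each taken in both orientations: $(0,1)$ with label $1$, $(k,k+1)$ with label $2k$ for $1\le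 k\le r$, $(k,k')$ with label $2k-1$ for $2\le k\le r$, and $(r+1,r+2)$ with label $2r+1$. An oriented edge has weight $1$ if it points away from the vertex $0$, and weight $y_j$ if it points towards $0$ and has label $j$. The weight of a path is the product of the weights of its steps, and the weight of a family of paths is the product of the weights of its members. For $1\le\alpha\le r$ and $n\ge\alpha-1$ let $\mathcal Z_{\alpha,n}$ be the sum of the weights of all families of $\alpha$ paths on $\widetilde G_r$, drawn in the plane with time as abscissa (one unit of time per step), the $i$-th of which starts at the vertex $0$ at time $2i-2$ and ends at the vertex $0$ at time $2n+2\alpha-2i$ ($i=1,\dots,\alpha$), such that no two paths are at the same vertex at the same time. Then: (a) There is a solution of the $Q$-system, in the field of rational functions in $2r$ variables, whose initial data are the $2r$ variables; and every solution, in any field, whose initial data are algebraically independent over $\mathbb Z$ is non-vanishing. (b) There are exponent vectors in $\mathbb Z^{2r}$ and Laurent polynomials $P_{\alpha,n}$ in $2r$ variables with non-negative integer coefficients ($1\le\alpha\le r$, $n\in\mathbb Z$), depending only on $r$, such that for every field and every non-vanishing solution of the $Q$-system in it: 1. each weight $y_j$, $1\le j\le 2r+1$, is the Laurent monomial in $\mathbf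 x_0$ with the $j$-th of these exponent vectors; 2. $R_{\alpha,n}=(R_{1,0})^{\alpha}\,\mathcal Z_{\alpha,n}$ for all $1\le\alpha\le r$ and all $n\ge\alpha-1$; 3. $R_{\alpha,n}=P_{\alpha,n}(\mathbf x_0)$ for all $1\le\alpha\le r$ and all $n\in\mathbb Z$. -/

import Mathlib

namespace QSystem

/-- The `A_r` `Q`-system for a family `R α n` (`0 ≤ α ≤ r + 1`, `n ∈ ℤ`), with its boundary
conditions. Values of `R α` for `α > r + 1` play no role. -/
structure IsSolution {K : Type*} [Field K] (r : ℕ) (R : ℕ → ℤ → K) : Prop where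
  rel : ∀ α : ℕ, 1 ≤ α → α ≤ r → ∀ n : ℤ,
    R α (n + 1) * R α (n - 1) = R α n ^ 2 + R (α + 1) n * R (α - 1) n
  left : ∀ n : ℤ, R 0 n = 1
  right : ∀ n : ℤ, R (r + 1) n = 1

/-- All the variables `R α n`, `1 ≤ α ≤ r`, are nonzero, so that the recursion determines them
from the initial data. -/
def NonVanishing {K : Type*} [Field K] (r : ℕ) (R : ℕ → ℤ → K) : Prop :=
  ∀ α : ℕ, 1 ≤ α → α ≤ r → ∀ n : ℤ, R α n ≠ 0

/-- Labels of the `2r` initial variables: `(i, k)` stands for `R_{i+1, k}`, `k = 0, 1`. -/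
abbrev InitVar (r : ℕ) : Type := Fin r × Fin 2

/-- The initial data `(R_{α,0}, R_{α,1})`, `1 ≤ α ≤ r`. -/
def initialData {K : Type*} (r : ℕ) (R : ℕ → ℤ → K) (v : InitVar r) : K :=
  R ((v.1 : ℕ) + 1) ((v.2 : ℕ) : ℤ)

/-- The Laurent monomial with exponent vector `m`, evaluated at `x`. -/
def laurentMonomial {K : Type*} [Field K] {ι : Type*} [Fintype ι] (m : ι → ℤ) (x : ι → K) : K :=
  ∏ v, x v ^ m v

/-- Laurent polynomials with non-negative integer coefficients in variables indexed by `ι`: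
finitely supported functions from exponent vectors to coefficients. -/
abbrev PosLaurent (ι : Type*) : Type _ := (ι → ℤ) →₀ ℕ

/-- Evaluation of such a Laurent polynomial at `x`. -/
def PosLaurent.eval {K : Type*} [Field K] {ι : Type*} [Fintype ι]
    (P : PosLaurent ι) (x : ι → K) : K :=
  P.sum fun m c => (c : K) * laurentMonomial m x

/-- The weights `y_j`, `1 ≤ j ≤ 2r + 1`:
`y_{2α-1} = R_{α-1,0} R_{α,1} / (R_{α,0} R_{α-1,1})` for `1 ≤ α ≤ r + 1` and
`y_{2α} = R_{α-1,0} R_{α+1,1} / (R_{α,0} R_{α,1})` for `1 ≤ α ≤ r`. -/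
def weight {K : Type*} [Field K] (R : ℕ → ℤ → K) (j : ℕ) : K :=
  if j % 2 = 1 then
    R ((j - 1) / 2) 0 * R ((j + 1) / 2) 1 / (R ((j + 1) / 2) 0 * R ((j - 1) / 2) 1)
  else
    R (j / 2 - 1) 0 * R (j / 2 + 1) 1 / (R (j / 2) 0 * R (j / 2) 1)

/-- The `2r + 2` vertices of `G̃_r`: `Sum.inl k` is the vertex `k`, `0 ≤ k ≤ r + 2`, and
`Sum.inr k` is the vertex `(k + 2)'`, where `2 ≤ k + 2 ≤ r`. -/
abbrev Vertex (r : ℕ) : Type := Fin (r + 3) ⊕ Fin (r - 1)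

/-- The oriented edges of `G̃_r`: both orientations of `(k, k + 1)`, `0 ≤ k ≤ r + 1`, and of
`(k, k')`, `2 ≤ k ≤ r`. -/
def Arrow (r : ℕ) : Vertex r → Vertex r → Prop
  | Sum.inl a, Sum.inl b => (b : ℕ) = a + 1 ∨ (a : ℕ) = b + 1
  | Sum.inl a, Sum.inr b => (a : ℕ) = b + 2
  | Sum.inr a, Sum.inl b => (b : ℕ) = a + 2
  | Sum.inr _, Sum.inr _ => False

/-- The label of the edge `(k, k + 1)` of `G̃_r`: `1` for `k = 0`, `2k` for `1 ≤ k ≤ r`, and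
`2r + 1` for `k = r + 1`. -/
def chainLabel (r k : ℕ) : ℕ :=
  if k = 0 then 1 else if k ≤ r then 2 * k else 2 * r + 1

/-- The weight of an oriented edge of `G̃_r` (meaningful on arrows only): `1` for an edge pointing
away from the vertex `0`, and `y_j` for the edge labelled `j` pointing towards `0`; the label of
`(k, k')` is `2k - 1`. -/
def edgeWeight {K : Type*} [Field K] (r : ℕ) (y : ℕ → K) : Vertex r → Vertex r → K
  | Sum.inl a, Sum.inl b => if (a : ℕ) < b then 1 else y (chainLabel r b)
  | Sum.inl _, Sum.inr _ => 1
  | Sum.inr a, Sum.inl _ => y (2 * ((a : ℕ) + 2) - 1)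
  | Sum.inr _, Sum.inr _ => 1

/-- `p` is a path with `ℓ` steps on `G̃_r` from the vertex `0` to itself. -/
def IsPath (r ℓ : ℕ) (p : Fin (ℓ + 1) → Vertex r) : Prop :=
  p 0 = Sum.inl 0 ∧ p (Fin.last ℓ) = Sum.inl 0 ∧ ∀ i : Fin ℓ, Arrow r (p i.castSucc) (p i.succ)

/-- The weight of a path: the product of the weights of its steps. -/
def pathWeight {K : Type*} [Field K] (r : ℕ) (y : ℕ → K) {ℓ : ℕ} (p : Fin (ℓ + 1) → Vertex r) : K :=
  ∏ i : Fin ℓ, edgeWeight r y (p i.castSucc) (p i.succ)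

/-- Families of `α` non-intersecting paths on `G̃_r`, drawn in the plane with time as abscissa, the
`i`-th one going from `(s i, 0)` to `(e i, 0)`: `p i a` is the vertex that the `i`-th path visits at
time `s i + a`, and no two paths visit the same vertex at the same time. (Two paths that are both at
`k'` at a time were both at `k` one time unit earlier, so it makes no difference whether the
midpoints `k'` of the horizontal steps count as points of the paths.) -/
def IsNonIntersectingFamily (r : ℕ) {α : ℕ} (s e : Fin α → ℕ)
    (p : ∀ i : Fin α, Fin (e i - s i + 1) → Vertex r) : Prop :=
  (∀ i, s i ≤ e i) ∧ (∀ i, IsPath r (e i - s i) (p i)) ∧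
    ∀ i j, i ≠ j → ∀ (a : Fin (e i - s i + 1)) (b : Fin (e j - s j + 1)),
      s i + (a : ℕ) = s j + (b : ℕ) → p i a ≠ p j b

open Classical in
/-- The partition function of families of `α` non-intersecting weighted paths on `G̃_r`. -/
noncomputable def pathPartition {K : Type*} [Field K] (r : ℕ) (y : ℕ → K) {α : ℕ}
    (s e : Fin α → ℕ) : K :=
  ∑ p : (∀ i : Fin α, Fin (e i - s i + 1) → Vertex r) with IsNonIntersectingFamily r s e p,
    ∏ i, pathWeight r y (p i)

/-- Starting abscissas `2i - 2`, `i = 1, …, α` (here `i` counts from `0`). -/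
def startTime (α : ℕ) (i : Fin α) : ℕ := 2 * ((i : ℕ) + 1) - 2

/-- Ending abscissas `2n + 2α - 2i`, `i = 1, …, α` (here `i` counts from `0`). -/
def endTime (n α : ℕ) (i : Fin α) : ℕ := 2 * n + 2 * α - 2 * ((i : ℕ) + 1)

end QSystem

/-!
The Desnanot–Jacobi identity turns the `Q`-system into the statement that `R α n` is a Hankel
determinant of the first row `R 1`. The weights `y` of a solution and those of its translate by one
step satisfy the rhombus rules of the quotient-difference algorithm; therefore `R 1 n / R 1 0` is
the weighted number of closed paths of length `2 n` at the vertex `0` of `G̃_r`, and the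
Lindström–Gessel–Viennot lemma rewrites the Hankel determinants as sums over non-intersecting
families. Paths of the family may start after others have ended or not yet begun, so each is kept in
a private waiting room outside the graph before it starts and after it ends.

This gives positivity for `α ≤ n + 1`. For `α > n + 1` the value `R α n` does not feel the boundary
`R 0 = 1`, and agrees with a value in a system of smaller rank to which the path formula applies.
Time reversal handles `n < 0`. Generic initial data give a non-vanishing solution because they
specialize to `1`, where the recursion produces positive rational numbers.
-/

namespace QSystem

open Matrix

section Determinants

variable {A : Type*} [CommRing A]

theorem det_one_updateCol_updateCol {ι : Type*} [Fintype ι] [DecidableEq ι]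
    {a b : ι} (hab : a ≠ b) (u v : ι → A) :
    (((1 : Matrix ι ι A).updateCol a u).updateCol b v).det = u a * v b - u b * v a := by
  -- The matrix differs from the identity by `U * V` with `U` of width two, and
  -- `det (1 + U * V) = det (1 + V * U)` is a two by two determinant.
  let U : Matrix ι (Fin 2) A := .of fun i => ![u i - if i = a then 1 else 0,
    v i - if i = b then 1 else 0]
  let V : Matrix (Fin 2) ι A := .of ![Pi.single a 1, Pi.single b 1]
  have h : ((1 : Matrix ι ι A).updateCol a u).updateCol b v = 1 + U * V := by
    ext i j
    by_cases hb : j = b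
    · simp [U, V, hb, hab, mul_apply, one_apply]
    · by_cases ha : j = a
      · simp [U, V, ha, hab, mul_apply, one_apply]
      · simp [U, V, ha, hb, mul_apply]
  rw [h, det_one_add_mul_comm, det_fin_two]
  simp [U, V, hab, hab.symm, mul_comm (u b)]

theorem det_mul_adjugate_minor {ι : Type*} [Fintype ι] [DecidableEq ι] (M : Matrix ι ι A)
    {a b : ι} (hab : a ≠ b) :
    M.det * (M.adjugate a a * M.adjugate b b - M.adjugate b a * M.adjugate a b) =
      M.det * (M.det * ((M.updateCol a (Pi.single a 1)).updateCol b (Pi.single b 1)).det) := by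
  have hcol (j : ι) : M *ᵥ (fun i => M.adjugate i j) = M.det • Pi.single j 1 := by
    ext i
    simpa [mulVec, dotProduct, mul_apply, one_apply, Pi.single_apply] using
      congrFun₂ (mul_adjugate M) i j
  rw [← det_one_updateCol_updateCol hab (fun i => M.adjugate i a) (fun i => M.adjugate i b),
    ← det_mul, mul_updateCol, mul_updateCol, mul_one, hcol, hcol, det_updateCol_smul,
    updateCol_comm _ hab, det_updateCol_smul, updateCol_comm _ hab.symm]

theorem adjugate_minor {ι : Type*} [Fintype ι] [DecidableEq ι] (M : Matrix ι ι A)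
    {a b : ι} (hab : a ≠ b) :
    M.adjugate a a * M.adjugate b b - M.adjugate b a * M.adjugate a b =
      M.det * ((M.updateCol a (Pi.single a 1)).updateCol b (Pi.single b 1)).det := by
  let X := mvPolynomialX ι ι ℤ
  let f : MvPolynomial (ι × ι) ℤ →+* A := (MvPolynomial.aeval fun p : ι × ι => M p.1 p.2).toRingHom
  have hf : f.mapMatrix X = M := mvPolynomialX_mapMatrix_aeval ℤ M
  have hX := congrArg f (mul_left_cancel₀ (det_mvPolynomialX_ne_zero ι ℤ)
    (det_mul_adjugate_minor X hab))
  have hadj (i j : ι) : f (X.adjugate i j) = M.adjugate i j := by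
    simpa [hf] using congrFun₂ (f.map_adjugate X) i j
  have hupd : f.mapMatrix ((X.updateCol a (Pi.single a 1)).updateCol b (Pi.single b 1)) =
      (M.updateCol a (Pi.single a 1)).updateCol b (Pi.single b 1) := by
    rw [← hf]
    ext i j
    simp only [RingHom.mapMatrix_apply, map_apply, updateCol_apply, Pi.single_apply]
    split_ifs <;> simp
  simpa only [map_sub, map_mul, hadj, RingHom.map_det, hf, hupd] using hX

theorem det_updateCol_zero_updateCol_last {m : ℕ} (M : Matrix (Fin (m + 2)) (Fin (m + 2)) A) :
    ((M.updateCol 0 (Pi.single 0 1)).updateCol (Fin.last _) (Pi.single (Fin.last _) 1)).det =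
      (M.submatrix (fun i : Fin m => i.castSucc.succ) fun i => i.castSucc.succ).det := by
  have h0l : (0 : Fin (m + 2)) ≠ Fin.last _ := Fin.last_pos.ne
  rw [updateCol_comm _ h0l, det_succ_column_zero, Finset.sum_eq_single 0 _ (by simp)]
  · rw [det_succ_column _ (Fin.last m), Finset.sum_eq_single (Fin.last m) _ (by simp)]
    · have hsub : (((M.updateCol (Fin.last _) (Pi.single (Fin.last _) 1)).updateCol 0
          (Pi.single 0 1)).submatrix (Fin.succAbove 0 ∘ (Fin.last m).succAbove)
            (Fin.succ ∘ (Fin.last m).succAbove)) =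
          M.submatrix (fun i : Fin m => i.castSucc.succ) fun i => i.castSucc.succ := by
        ext i j
        simp [Fin.ext_iff, j.2.ne]
      rw [submatrix_submatrix, hsub]
      simp [Fin.ext_iff, ← two_mul, pow_mul]
    · intro i _ hi
      simp [Fin.succ_inj, ← Fin.succ_last, hi]
  · intro i _ hi
    simp [hi]

theorem desnanot_jacobi {m : ℕ} (M : Matrix (Fin (m + 2)) (Fin (m + 2)) A) :
    (M.submatrix Fin.succ Fin.succ).det * (M.submatrix Fin.castSucc Fin.castSucc).det
      - (M.submatrix Fin.castSucc Fin.succ).det * (M.submatrix Fin.succ Fin.castSucc).det =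
    M.det * (M.submatrix (fun i : Fin m => i.castSucc.succ) fun i => i.castSucc.succ).det := by
  have h := adjugate_minor M (Fin.last_pos (n := m)).ne
  simp only [adjugate_fin_succ_eq_det_submatrix, Fin.succAbove_zero, Fin.succAbove_last,
    Fin.val_zero, Fin.val_last, add_zero, zero_add, pow_zero, one_mul,
    (Even.add_self (m + 1)).neg_one_pow] at h
  have hsign : ((-1 : A) ^ (m + 1)) * (-1) ^ (m + 1) = 1 := by rw [← mul_pow]; simp
  rw [← det_updateCol_zero_updateCol_last, ← h]
  linear_combination (M.submatrix Fin.castSucc Fin.succ).det *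
    (M.submatrix Fin.succ Fin.castSucc).det * hsign

/-- The Hankel determinant `det (u (n - α + 1 + i + j))`, `0 ≤ i, j < α`; its entries on the
antidiagonal are `u n`. -/
noncomputable def hankelDet (u : ℤ → A) (α : ℕ) (n : ℤ) : A :=
  (Matrix.of fun i j : Fin α => u (n - α + 1 + (i : ℕ) + (j : ℕ))).det

theorem hankelDet_zero (u : ℤ → A) (n : ℤ) : hankelDet u 0 n = 1 := by
  simp [hankelDet]

theorem hankelDet_one (u : ℤ → A) (n : ℤ) : hankelDet u 1 n = u n := by
  simp [hankelDet]

theorem hankelDet_rel (u : ℤ → A) (α : ℕ) (n : ℤ) :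
    hankelDet u (α + 1) (n + 1) * hankelDet u (α + 1) (n - 1) =
      hankelDet u (α + 1) n ^ 2 + hankelDet u (α + 2) n * hankelDet u α n := by
  let H : Matrix (Fin (α + 2)) (Fin (α + 2)) A :=
    .of fun i j => u (n - (α + 2 : ℕ) + 1 + (i : ℕ) + (j : ℕ))
  have hminor {k : ℕ} (f g : Fin k → Fin (α + 2)) (m : ℤ)
      (hfg : ∀ i j, (n - (α + 2 : ℕ) + (f i : ℕ) + (g j : ℕ) : ℤ) = m - k + (i : ℕ) + (j : ℕ)) :
      (H.submatrix f g).det = hankelDet u k m := by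
    refine congrArg det (ext fun i j => congrArg u ?_)
    linear_combination hfg i j
  have h := desnanot_jacobi H
  rw [hminor Fin.succ Fin.succ (n + 1) (by intros; push_cast [Fin.val_succ]; ring),
    hminor Fin.castSucc Fin.castSucc (n - 1) (by intros; push_cast [Fin.val_castSucc]; ring),
    hminor Fin.castSucc Fin.succ n (by intros; push_cast [Fin.val_succ, Fin.val_castSucc]; ring),
    hminor Fin.succ Fin.castSucc n (by intros; push_cast [Fin.val_succ, Fin.val_castSucc]; ring),
    hminor (fun i => i.castSucc.succ) (fun i => i.castSucc.succ) n
      (by intros; push_cast [Fin.val_succ, Fin.val_castSucc]; ring),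
    show H.det = hankelDet u (α + 2) n from rfl] at h
  linear_combination h

variable {K : Type*} [Field K] {r : ℕ} {R : ℕ → ℤ → K}

theorem IsSolution.ne_zero (hR : IsSolution r R) (hnv : NonVanishing r R) {α : ℕ}
    (hα : α ≤ r + 1) (n : ℤ) : R α n ≠ 0 := by
  rcases Nat.eq_zero_or_pos α with rfl | hpos
  · simp [hR.left]
  · rcases hα.eq_or_lt with rfl | hlt
    · simp [hR.right]
    · exact hnv α hpos (by omega) n

theorem IsSolution.eq_hankelDet (hR : IsSolution r R) (hnv : NonVanishing r R) {α : ℕ}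
    (hα : α ≤ r + 1) (n : ℤ) : R α n = hankelDet (R 1) α n := by
  induction α using Nat.twoStepInduction generalizing n with
  | zero => rw [hR.left, hankelDet_zero]
  | one => exact (hankelDet_one _ _).symm
  | more α ih₀ ih₁ =>
    have hne : R α n ≠ 0 := hR.ne_zero hnv (by omega) n
    have hrel := hR.rel (α + 1) (by omega) (by omega) n
    have hdet := hankelDet_rel (R 1) α n
    simp only [← ih₁ (by omega), ← ih₀ (by omega)] at hdet
    rw [add_tsub_cancel_right] at hrel
    exact mul_right_cancel₀ hne (by linear_combination hdet - hrel)

end Determinants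

section LindstromGesselViennot

variable {S : Type*} {α : ℕ}

theorem eq_of_forall_exists_eq {lt : S → S → Prop} (hlt : ∀ a b, lt a b → ¬ lt b a)
    {v b : Fin α → S} (hv : ∀ i j, i < j → lt (v i) (v j)) (hb : ∀ i j, i < j → lt (b i) (b j))
    (hvb : ∀ i, ∃ j, v i = b j) : v = b := by
  choose σ hσ using hvb
  have hmono : StrictMono σ := fun i j hij => by
    have h := hv i j hij
    rw [hσ, hσ] at h
    refine lt_of_not_ge fun hji => ?_
    rcases hji.lt_or_eq with hlt' | heq
    · exact hlt _ _ h (hb _ _ hlt')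
    · exact hlt _ _ (heq ▸ h) (heq ▸ h)
  funext i
  rw [hσ, hmono.eq_id, id]

variable {A : Type*} [CommRing A] [Fintype S] [DecidableEq S]

/-- The product `T t * T (t + 1) * ⋯ * T (t + L - 1)`: its entry `(a, b)` is the weighted number of
walks from `a` to `b` during the `L` time units that follow the time `t`, the weight of a step from
`c` to `d` at the time `s` being `T s c d`. -/
def transferProd (T : ℕ → Matrix S S A) : ℕ → ℕ → Matrix S S A
  | _, 0 => 1
  | t, L + 1 => T t * transferProd T (t + 1) L

open Classical in
/-- The weighted number of families of `α` walks from `v` at time `t` to `b` at time `t + L` that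
are at pairwise distinct positions at every time; `q s i` is the position of the `i`-th walk at time
`t + s`. -/
noncomputable def disjointWalkSum (T : ℕ → Matrix S S A) (t L : ℕ) (v b : Fin α → S) : A :=
  ∑ q : Fin (L + 1) → Fin α → S with
    q 0 = v ∧ q (Fin.last L) = b ∧ ∀ s, Function.Injective (q s),
    ∏ s : Fin L, ∏ i, T (t + s) (q s.castSucc i) (q s.succ i)

theorem disjointWalkSum_zero (T : ℕ → Matrix S S A) (t : ℕ) {v : Fin α → S}
    (hv : Function.Injective v) (b : Fin α → S) :
    disjointWalkSum T t 0 v b = if v = b then 1 else 0 := by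
  classical
  rw [disjointWalkSum, Finset.sum_filter, ← (Equiv.funUnique (Fin 1) (Fin α → S)).symm.sum_comp,
    Finset.sum_eq_single v (fun q _ hq => if_neg fun h => hq h.1) (by simp)]
  simp [hv]

theorem disjointWalkSum_of_not_injective (T : ℕ → Matrix S S A) (t L : ℕ) {v : Fin α → S}
    (hv : ¬ Function.Injective v) (b : Fin α → S) : disjointWalkSum T t L v b = 0 := by
  rw [disjointWalkSum, Finset.filter_false_of_mem, Finset.sum_empty]
  rintro q - ⟨rfl, -, hq⟩
  exact hv (hq 0)

theorem disjointWalkSum_succ (T : ℕ → Matrix S S A) (t L : ℕ) {v : Fin α → S}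
    (hv : Function.Injective v) (b : Fin α → S) :
    disjointWalkSum T t (L + 1) v b =
      ∑ w : Fin α → S, (∏ i, T t (v i) (w i)) * disjointWalkSum T (t + 1) L w b := by
  classical
  simp only [disjointWalkSum, Finset.sum_filter]
  rw [← (Fin.consEquiv fun _ => Fin α → S).sum_comp, Fintype.sum_prod_type,
    Finset.sum_eq_single v
      (fun w _ hw => Finset.sum_eq_zero fun q _ => if_neg fun h => hw (by simpa using h.1))
      (by simp)]
  simp_rw [Finset.mul_sum]
  rw [Finset.sum_comm]
  refine Finset.sum_congr rfl fun q _ => ?_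
  rw [Finset.sum_eq_single (q 0) (fun w _ hw => by rw [if_neg fun h => hw h.1.symm, mul_zero])
    (by simp)]
  have hcond : ((Fin.cons v q : Fin (L + 2) → Fin α → S) 0 = v ∧
      (Fin.cons v q : Fin (L + 2) → Fin α → S) (Fin.last (L + 1)) = b ∧
        ∀ s, Function.Injective ((Fin.cons v q : Fin (L + 2) → Fin α → S) s)) ↔
      q 0 = q 0 ∧ q (Fin.last L) = b ∧ ∀ s, Function.Injective (q s) := by
    simp [Fin.forall_fin_succ, ← Fin.succ_last, hv]
  simp only [Fin.consEquiv_apply, hcond, mul_ite, mul_zero]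
  refine if_congr Iff.rfl ?_ rfl
  rw [Fin.prod_univ_succ]
  simp [add_assoc, add_comm 1]

theorem det_transferProd_succ (T : ℕ → Matrix S S A) (t L : ℕ) (v b : Fin α → S) :
    (Matrix.of fun i j => transferProd T t (L + 1) (v i) (b j)).det =
      ∑ w : Fin α → S, (∏ i, T t (v i) (w i)) *
        (Matrix.of fun i j => transferProd T (t + 1) L (w i) (b j)).det := by
  let row (s : S) : Fin α → A := fun j => transferProd T (t + 1) L s (b j)
  have hrow : (Matrix.of fun i j => transferProd T t (L + 1) (v i) (b j)) =
      fun i => ∑ s : S, T t (v i) s • row s := by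
    ext i j
    simp [row, transferProd, mul_apply, Finset.sum_apply]
  rw [hrow]
  exact (detRowAlternating.toMultilinearMap.map_sum fun i s => T t (v i) s • row s).trans
    (Finset.sum_congr rfl fun w _ =>
      detRowAlternating.toMultilinearMap.map_smul_univ (fun i => T t (v i) (w i))
        fun i => row (w i))

/-- Disjoint walks keep their order, so that only the identity contributes to the
Lindström–Gessel–Viennot determinant. -/
theorem det_transferProd_eq_disjointWalkSum {lt : ℕ → S → S → Prop}
    (hlt : ∀ t a b, lt t a b → ¬ lt t b a) (T : ℕ → Matrix S S A)
    (hT : ∀ t a a' b b', lt t a b → T t a a' ≠ 0 → T t b b' ≠ 0 → a' = b' ∨ lt (t + 1) a' b')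
    (L : ℕ) {t : ℕ} {v b : Fin α → S} (hv : ∀ i j, i < j → lt t (v i) (v j))
    (hb : ∀ i j, i < j → lt (t + L) (b i) (b j)) :
    (Matrix.of fun i j => transferProd T t L (v i) (b j)).det = disjointWalkSum T t L v b := by
  have hinj {t : ℕ} {v : Fin α → S} (hv : ∀ i j, i < j → lt t (v i) (v j)) :
      Function.Injective v :=
    .of_lt_imp_ne fun i j hij h => hlt _ _ _ (hv i j hij) (h ▸ hv i j hij)
  induction L generalizing t v with
  | zero =>
    rw [disjointWalkSum_zero T t (hinj hv)]
    split_ifs with h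
    · rw [h, ← det_one (n := Fin α)]
      congr 1
      ext i j
      simp [transferProd, one_apply, (hinj hb).eq_iff]
    · obtain ⟨i, hi⟩ : ∃ i, ∀ j, v i ≠ b j := by
        by_contra! hcon
        exact h (eq_of_forall_exists_eq (hlt t) hv hb hcon)
      exact det_eq_zero_of_row_eq_zero i fun j => by simp [transferProd, hi j]
  | succ L ih =>
    rw [det_transferProd_succ, disjointWalkSum_succ T t L (hinj hv)]
    refine Finset.sum_congr rfl fun w _ => ?_
    by_cases hw : ∃ i, T t (v i) (w i) = 0
    · obtain ⟨i, hi⟩ := hw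
      rw [Finset.prod_eq_zero (Finset.mem_univ i) hi, zero_mul, zero_mul]
    push Not at hw
    by_cases hwi : Function.Injective w
    · have hlt_w (i j) (hij : i < j) : lt (t + 1) (w i) (w j) :=
        (hT t _ _ _ _ (hv i j hij) (hw i) (hw j)).resolve_left (hwi.ne hij.ne)
      rw [ih hlt_w (by rwa [Nat.succ_add_eq_add_succ])]
    · rw [disjointWalkSum_of_not_injective T _ _ hwi]
      obtain ⟨i, j, hij, hne⟩ := Function.not_injective_iff.mp hwi
      rw [det_zero_of_row_eq hne (by ext k; simp [hij])]

theorem transferProd_apply_eq_sum (T : ℕ → Matrix S S A) (t L : ℕ) (a b : S) :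
    transferProd T t L a b = ∑ w : Fin (L + 1) → S with w 0 = a ∧ w (Fin.last L) = b,
      ∏ s : Fin L, T (t + s) (w s.castSucc) (w s.succ) := by
  have h := det_transferProd_eq_disjointWalkSum (α := 1) (lt := fun _ _ _ => False) (by simp) T
    (by simp) L (t := t) (v := fun _ => a) (b := fun _ => b) (by simp) (by simp)
  rw [det_unique, of_apply] at h
  rw [h, disjointWalkSum, Finset.sum_filter, Finset.sum_filter,
    ← (Equiv.piCongrRight fun _ : Fin (L + 1) => Equiv.funUnique (Fin 1) S).symm.sum_comp]
  refine Finset.sum_congr rfl fun w _ => ?_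
  simp [funext_iff, Function.injective_of_subsingleton]

theorem transferProd_const (M : Matrix S S A) (t L : ℕ) :
    transferProd (fun _ => M) t L = M ^ L := by
  induction L generalizing t with
  | zero => rw [transferProd, pow_zero]
  | succ L ih => rw [transferProd, ih, pow_succ']

end LindstromGesselViennot

section NonIntersectingPaths

/-- The distance of a vertex of `G̃_r` from the vertex `0`. -/
def depth {r : ℕ} : Vertex r → ℕ
  | Sum.inl k => k
  | Sum.inr k => k + 3

/-- The height at which a vertex of `G̃_r` is drawn in the plane, with `k'` between `k` and `k + 1`:
then two paths cannot cross without meeting. -/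
def height {r : ℕ} : Vertex r → ℕ
  | Sum.inl k => 2 * k
  | Sum.inr k => 2 * k + 5

theorem height_injective {r : ℕ} : Function.Injective (height : Vertex r → ℕ) := by
  rintro (a | a) (b | b) h <;> simp only [height] at h <;>
    first | omega | (simp only [Sum.inl.injEq, Sum.inr.injEq, Fin.ext_iff]; omega)

theorem Arrow.depth_eq {r : ℕ} {a b : Vertex r} (h : Arrow r a b) :
    depth b = depth a + 1 ∨ depth a = depth b + 1 := by
  rcases a with a | a <;> rcases b with b | b <;> simp only [Arrow, depth] at h ⊢ <;> omega

theorem Arrow.height_le {r : ℕ} {a a' b b' : Vertex r} (ha : Arrow r a a') (hb : Arrow r b b')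
    (hpar : depth a % 2 = depth b % 2) (hlt : height b < height a) : height b' ≤ height a' := by
  rcases a with a | a <;> rcases b with b | b <;> rcases a' with a' | a' <;>
    rcases b' with b' | b' <;> simp only [Arrow, depth, height] at ha hb hpar hlt ⊢ <;> omega

variable {K : Type*} [Field K] {r α : ℕ} {y : ℕ → K} {s e : Fin α → ℕ}

open Classical in
/-- The weighted adjacency matrix of `G̃_r`. -/
noncomputable def adjacency (r : ℕ) (y : ℕ → K) : Matrix (Vertex r) (Vertex r) K :=
  .of fun a b => if Arrow r a b then edgeWeight r y a b else 0

theorem arrow_of_adjacency_ne_zero {a b : Vertex r} (h : adjacency r y a b ≠ 0) : Arrow r a b :=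
  of_not_not fun hab => h (if_neg hab)

theorem IsPath.prod_adjacency {ℓ : ℕ} {p : Fin (ℓ + 1) → Vertex r} (hp : IsPath r ℓ p) :
    ∏ k : Fin ℓ, adjacency r y (p k.castSucc) (p k.succ) = pathWeight r y p :=
  Finset.prod_congr rfl fun k _ => if_pos (hp.2.2 k)

open Classical in
theorem adjacency_pow_eq_sum (r : ℕ) (y : ℕ → K) (ℓ : ℕ) :
    (adjacency r y ^ ℓ) (Sum.inl 0) (Sum.inl 0) =
      ∑ p : Fin (ℓ + 1) → Vertex r with IsPath r ℓ p, pathWeight r y p := by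
  rw [← transferProd_const _ 0, transferProd_apply_eq_sum]
  symm
  refine Finset.sum_subset_zero_on_sdiff (fun p => ?_) (fun p hp => ?_) fun p hp => ?_
  · simp only [Finset.mem_filter_univ]
    exact fun hp => ⟨hp.1, hp.2.1⟩
  · simp only [Finset.mem_sdiff, Finset.mem_filter_univ] at hp
    obtain ⟨k, hk⟩ : ∃ k : Fin ℓ, ¬ Arrow r (p k.castSucc) (p k.succ) := by
      by_contra! h
      exact hp.2 ⟨hp.1.1, hp.1.2, h⟩
    exact Finset.prod_eq_zero (Finset.mem_univ k) (if_neg hk)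
  · exact ((Finset.mem_filter_univ p).mp hp).prod_adjacency.symm

/-- The vertices of `G̃_r` together with a waiting room for each of `α` paths. -/
abbrev RoomVertex (r α : ℕ) : Type := Vertex r ⊕ Fin α

/-- Transfer matrices on `RoomVertex r α` which make all paths of a family start and end
simultaneously: the `i`-th path waits in its room until it enters `G̃_r` at `(s i, 0)`, and it
returns to its room after it has left at `(e i, 0)`. The walk is at time `t + 1` where the path is
at time `t`, so that every walk starts in its room at time `0`. -/
noncomputable def roomMatrix (r : ℕ) (y : ℕ → K) (s e : Fin α → ℕ) (t : ℕ) :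
    Matrix (RoomVertex r α) (RoomVertex r α) K :=
  fromBlocks (adjacency r y) (.of fun a i => if a = Sum.inl 0 ∧ t = e i + 1 then 1 else 0)
    (.of fun i b => if b = Sum.inl 0 ∧ t = s i then 1 else 0)
    (.of fun i j => if i = j ∧ (t < s i ∨ e i + 1 < t) then 1 else 0)

/-- The steps of a walk on `RoomVertex r α` that `roomMatrix` allows at time `t`. -/
def RoomStep (s e : Fin α → ℕ) (t : ℕ) : RoomVertex r α → RoomVertex r α → Prop
  | Sum.inl a, Sum.inl b => Arrow r a b
  | Sum.inl a, Sum.inr i => a = Sum.inl 0 ∧ t = e i + 1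
  | Sum.inr i, Sum.inl b => b = Sum.inl 0 ∧ t = s i
  | Sum.inr i, Sum.inr j => i = j ∧ (t < s i ∨ e i + 1 < t)

theorem roomStep_of_roomMatrix_ne_zero {t : ℕ} {a b : RoomVertex r α}
    (h : roomMatrix r y s e t a b ≠ 0) : RoomStep s e t a b := by
  rcases a with a | i <;> rcases b with b | j
  · exact arrow_of_adjacency_ne_zero h
  all_goals exact of_not_not fun hab => h (if_neg hab)

/-- The order on the positions at time `t` of non-intersecting paths, with outer paths first; all
starting times are congruent to `c` modulo `2`, which determines the parity of the depths. -/
def RoomLT (c t : ℕ) : RoomVertex r α → RoomVertex r α → Prop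
  | Sum.inl a, Sum.inl b =>
      height b < height a ∧ depth a % 2 = (t + 1 + c) % 2 ∧ depth b % 2 = (t + 1 + c) % 2
  | Sum.inl a, Sum.inr _ => depth a % 2 = (t + 1 + c) % 2
  | Sum.inr _, Sum.inl _ => False
  | Sum.inr i, Sum.inr j => i < j

theorem RoomLT.asymm {c t : ℕ} {a b : RoomVertex r α} (h : RoomLT c t a b) :
    ¬ RoomLT c t b a := by
  rcases a with a | a <;> rcases b with b | b <;> simp only [RoomLT] at h ⊢ <;> grind

theorem eq_or_roomLT_of_height_le {c t : ℕ} {a b : Vertex r} (h : height b ≤ height a)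
    (ha : depth a % 2 = (t + 1 + c) % 2) (hb : depth b % 2 = (t + 1 + c) % 2) :
    (Sum.inl a : RoomVertex r α) = Sum.inl b ∨
      RoomLT c t (Sum.inl a : RoomVertex r α) (Sum.inl b) := by
  rcases h.lt_or_eq with hlt | heq
  · exact .inr ⟨hlt, ha, hb⟩
  · exact .inl (congrArg Sum.inl (height_injective heq.symm))

theorem RoomLT.eq_or_roomLT {c t : ℕ} (hs : StrictMono s) (he : StrictAnti e)
    (hse : ∀ i j, s i ≤ e j) (hc : ∀ i, s i % 2 = c) {a a' b b' : RoomVertex r α}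
    (h : RoomLT c t a b) (ha : RoomStep s e t a a') (hb : RoomStep s e t b b') :
    a' = b' ∨ RoomLT c (t + 1) a' b' := by
  have height_zero : height (Sum.inl 0 : Vertex r) = 0 := rfl
  have depth_zero : depth (Sum.inl 0 : Vertex r) = 0 := rfl
  rcases a with a | i <;> rcases b with b | j <;> rcases a' with a' | k <;>
    rcases b' with b' | l <;> simp only [RoomStep] at ha hb <;> simp only [RoomLT] at h
  -- both paths are in the graph
  · have := ha.depth_eq
    have := hb.depth_eq
    exact eq_or_roomLT_of_height_le (ha.height_le hb (h.2.1.trans h.2.2.symm) h.1)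
      (by omega) (by omega)
  · have := ha.depth_eq
    exact .inr (show _ % 2 = _ by omega)
  · simp [ha.1, height_zero] at h
  · simp [ha.1, height_zero] at h
  -- only the first path is in the graph
  · have := ha.depth_eq
    have := hc j
    obtain ⟨rfl, htj⟩ := hb
    exact eq_or_roomLT_of_height_le (height_zero ▸ Nat.zero_le _) (by omega) (by omega)
  · have := ha.depth_eq
    exact .inr (show _ % 2 = _ by omega)
  · have := hse j k
    omega
  · have := hse j k
    obtain ⟨rfl, hj⟩ := hb
    exact .inr (he.lt_iff_gt.mp (by omega))
  -- both paths are in their rooms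
  · exact .inl (by rw [ha.1, hb.1])
  · have := hc i
    exact .inr (show _ % 2 = _ by rw [ha.1, depth_zero]; omega)
  · have := hse j i
    have := hs h
    omega
  · exact .inr (ha.1 ▸ hb.1 ▸ h)

/-- The walk on `RoomVertex r α` drawn by a path on `G̃_r` from `(s, 0)` to `(s + ℓ, 0)`, which
comes from the room `i` and goes to the room `j`. -/
def roomWalk {ℓ : ℕ} (s : ℕ) (p : Fin (ℓ + 1) → Vertex r) (i j : Fin α) (t : ℕ) : RoomVertex r α :=
  if t ≤ s then Sum.inr i
  else if h : t - (s + 1) < ℓ + 1 then Sum.inl (p ⟨t - (s + 1), h⟩) else Sum.inr j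

theorem roomWalk_of_le {ℓ s t : ℕ} (p : Fin (ℓ + 1) → Vertex r) (i j : Fin α) (h : t ≤ s) :
    roomWalk s p i j t = Sum.inr i :=
  if_pos h

theorem roomWalk_of_lt {ℓ s t : ℕ} (p : Fin (ℓ + 1) → Vertex r) (i j : Fin α)
    (h : s + ℓ + 1 < t) : roomWalk s p i j t = Sum.inr j := by
  rw [roomWalk, if_neg (by omega), dif_neg (by omega)]

theorem roomWalk_add {ℓ : ℕ} (s : ℕ) (p : Fin (ℓ + 1) → Vertex r) (i j : Fin α)
    (k : Fin (ℓ + 1)) : roomWalk s p i j (s + 1 + k) = Sum.inl (p k) := by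
  rw [roomWalk, if_neg (by omega), dif_pos (by omega)]
  simp

theorem IsPath.prod_roomMatrix {ℓ N : ℕ} {p : Fin (ℓ + 1) → Vertex r} (hp : IsPath r ℓ p)
    {i j : Fin α} (hℓ : s i + ℓ = e j) (hN : e j + 2 ≤ N) :
    ∏ t ∈ Finset.range N, roomMatrix r y s e t (roomWalk (s i) p i j t)
      (roomWalk (s i) p i j (t + 1)) = pathWeight r y p := by
  have hstart : roomWalk (s i) p i j (s i + 1) = Sum.inl (Sum.inl 0) := by
    simpa [hp.1] using roomWalk_add (s i) p i j 0
  have hend : roomWalk (s i) p i j (e j + 1) = Sum.inl (Sum.inl 0) := by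
    simpa [hp.2.1, ← hℓ, add_right_comm] using roomWalk_add (s i) p i j (Fin.last ℓ)
  have hsub : Finset.Ico (s i + 1) (e j + 1) ⊆ Finset.range N := fun t ht => by
    simp only [Finset.mem_Ico, Finset.mem_range] at ht ⊢
    omega
  rw [← Finset.prod_subset hsub fun t _ ht => ?_, Finset.prod_Ico_eq_prod_range,
    show e j + 1 - (s i + 1) = ℓ by omega, Finset.prod_range, ← hp.prod_adjacency]
  · refine Finset.prod_congr rfl fun k _ => ?_
    have hk : roomWalk (s i) p i j (s i + 1 + k) = Sum.inl (p k.castSucc) :=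
      roomWalk_add (s i) p i j k.castSucc
    have hk' : roomWalk (s i) p i j (s i + 1 + k + 1) = Sum.inl (p k.succ) :=
      roomWalk_add (s i) p i j k.succ
    rw [hk, hk', roomMatrix, fromBlocks_apply₁₁]
  · simp only [Finset.mem_Ico, not_and_or, not_le, not_lt] at ht
    obtain ht | rfl | rfl | ht : t < s i ∨ t = s i ∨ t = e j + 1 ∨ e j + 1 < t := by omega
    · rw [roomWalk_of_le p i j ht.le, roomWalk_of_le p i j ht]
      exact if_pos ⟨rfl, .inl ht⟩
    · rw [roomWalk_of_le p i j le_rfl, hstart]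
      exact if_pos ⟨rfl, rfl⟩
    · rw [hend, roomWalk_of_lt p i j (by omega)]
      exact if_pos ⟨rfl, rfl⟩
    · rw [roomWalk_of_lt p i j (by omega), roomWalk_of_lt p i j (by omega)]
      exact if_pos ⟨rfl, .inr ht⟩

section Walk

variable {N : ℕ} {W : ℕ → RoomVertex r α} (hW : ∀ t < N, RoomStep s e t (W t) (W (t + 1)))
include hW

theorem eq_room_of_le_start {i : Fin α} (h0 : W 0 = Sum.inr i) {t : ℕ} (hts : t ≤ s i)
    (htN : t ≤ N) : W t = Sum.inr i := by
  induction t with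
  | zero => exact h0
  | succ t ih =>
    have hstep := ih (by omega) (by omega) ▸ hW t htN
    rcases hWt : W (t + 1) with b | k <;> rw [hWt] at hstep
    · exact absurd hstep.2 (by omega)
    · rw [hstep.1]

theorem eq_zero_at_start {i : Fin α} (h0 : W 0 = Sum.inr i) (hsN : s i < N) (hse : s i ≤ e i) :
    W (s i + 1) = Sum.inl (Sum.inl 0) := by
  have hstep := eq_room_of_le_start hW h0 le_rfl hsN.le ▸ hW _ hsN
  rcases hWt : W (s i + 1) with b | k <;> rw [hWt] at hstep
  · rw [hstep.1]
  · exact absurd hstep.2 (by omega)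

theorem eq_room_of_eq_room {j : Fin α} (hse : s j ≤ e j) {t u : ℕ} (ht : W t = Sum.inr j)
    (het : e j + 1 < t) (htu : t ≤ u) (huN : u ≤ N) : W u = Sum.inr j := by
  induction u, htu using Nat.le_induction with
  | base => exact ht
  | succ u htu ih =>
    have hstep := ih (by omega) ▸ hW u huN
    rcases hWu : W (u + 1) with b | k <;> rw [hWu] at hstep
    · exact absurd hstep.2 (by omega)
    · rw [hstep.1]

theorem eq_room_of_end_lt {j : Fin α} (hN : W N = Sum.inr j) {t : ℕ} (het : e j + 1 < t)
    (htN : t ≤ N) : W t = Sum.inr j := by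
  induction htN using Nat.decreasingInduction with
  | self => exact hN
  | of_succ t htN ih =>
    have hstep := ih (by omega) ▸ hW t htN
    rcases hWt : W t with a | k <;> rw [hWt] at hstep
    · exact absurd hstep.2 (by omega)
    · rw [hstep.1]

theorem eq_zero_at_end {j : Fin α} (hN : W N = Sum.inr j) (hse : s j ≤ e j) (heN : e j + 2 ≤ N) :
    W (e j + 1) = Sum.inl (Sum.inl 0) := by
  have hstep := eq_room_of_end_lt hW hN (Nat.lt_succ_self _) heN ▸ hW (e j + 1) heN
  rcases hWt : W (e j + 1) with a | k <;> rw [hWt] at hstep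
  · rw [hstep.1]
  · obtain ⟨rfl, h⟩ := hstep
    omega

theorem exists_eq_inl (hse : ∀ i j, s i ≤ e j) {i j : Fin α} (h0 : W 0 = Sum.inr i)
    (hN : W N = Sum.inr j) {t : ℕ} (hst : s i < t) (hte : t ≤ e j + 1) (htN : t ≤ N) :
    ∃ a, W t = Sum.inl a := by
  induction t, hst using Nat.le_induction with
  | base => exact ⟨_, eq_zero_at_start hW h0 htN (hse i i)⟩
  | succ t hst ih =>
    obtain ⟨a, ha⟩ := ih (by omega) (by omega)
    have hstep := ha ▸ hW t htN
    rcases hWt : W (t + 1) with b | k <;> rw [hWt] at hstep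
    · exact ⟨b, rfl⟩
    · obtain ⟨-, rfl⟩ := hstep
      have hkj := eq_room_of_eq_room hW (hse k k) hWt (Nat.lt_succ_self _) htN le_rfl
      rw [hN, Sum.inr.injEq] at hkj
      subst hkj
      omega

theorem exists_isPath_eq_roomWalk (hse : ∀ i j, s i ≤ e j) {i j : Fin α} (h0 : W 0 = Sum.inr i)
    (hN : W N = Sum.inr j) (heN : e j + 2 ≤ N) :
    ∃ p : Fin (e j - s i + 1) → Vertex r, IsPath r (e j - s i) p ∧
      ∀ t ≤ N, W t = roomWalk (s i) p i j t := by
  have hij := hse i j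
  have hgraph (k : Fin (e j - s i + 1)) : ∃ a, W (s i + 1 + k) = Sum.inl a :=
    exists_eq_inl hW hse h0 hN (by omega) (by omega) (by omega)
  choose p hp using hgraph
  refine ⟨p, ⟨?_, ?_, fun k => ?_⟩, fun t htN => ?_⟩
  · have h := hp 0
    rw [Fin.val_zero, add_zero, eq_zero_at_start hW h0 (by omega) (hse i i)] at h
    exact (Sum.inl_injective h).symm
  · have h := hp (Fin.last _)
    rw [Fin.val_last, show s i + 1 + (e j - s i) = e j + 1 by omega,
      eq_zero_at_end hW hN (hse j j) heN] at h
    exact (Sum.inl_injective h).symm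
  · have h := hW (s i + 1 + k) (by omega)
    rwa [show W (s i + 1 + k) = _ from hp k.castSucc,
      show W (s i + 1 + k + 1) = _ from hp k.succ] at h
  · obtain hts | ⟨k, hk, rfl⟩ | het :
        t ≤ s i ∨ (∃ k < e j - s i + 1, t = s i + 1 + k) ∨ e j + 1 < t := by
      by_cases h : t ≤ s i ∨ e j + 1 < t
      · tauto
      · exact .inr (.inl ⟨t - (s i + 1), by omega, by omega⟩)
    · rw [eq_room_of_le_start hW h0 hts htN, roomWalk_of_le p i j hts]
    · exact (hp ⟨k, hk⟩).trans (roomWalk_add (s i) p i j ⟨k, hk⟩).symm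
    · rw [eq_room_of_end_lt hW hN het htN, roomWalk_of_lt p i j (by omega)]

end Walk

theorem exists_isPath_of_roomStep {N : ℕ} {w : Fin (N + 1) → RoomVertex r α}
    (hw : ∀ t : Fin N, RoomStep s e t (w t.castSucc) (w t.succ)) (hse : ∀ i j, s i ≤ e j)
    {i j : Fin α} (h0 : w 0 = Sum.inr i) (hN : w (Fin.last N) = Sum.inr j) (heN : e j + 2 ≤ N) :
    ∃ p : Fin (e j - s i + 1) → Vertex r, IsPath r (e j - s i) p ∧
      ∀ t : Fin (N + 1), w t = roomWalk (s i) p i j t := by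
  have hW (t : ℕ) (ht : t < N) :
      RoomStep s e t (w (Fin.ofNat (N + 1) t)) (w (Fin.ofNat (N + 1) (t + 1))) := by
    have h := hw ⟨t, ht⟩
    rwa [show (⟨t, ht⟩ : Fin N).castSucc = Fin.ofNat (N + 1) t from
        Fin.ext (Nat.mod_eq_of_lt (by omega)).symm,
      show (⟨t, ht⟩ : Fin N).succ = Fin.ofNat (N + 1) (t + 1) from
        Fin.ext (Nat.mod_eq_of_lt (by omega)).symm] at h
  obtain ⟨p, hp, hwp⟩ := exists_isPath_eq_roomWalk hW hse h0
    (by rw [← hN]; congr; exact Fin.ext (Nat.mod_eq_of_lt (by omega))) heN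
  refine ⟨p, hp, fun t => ?_⟩
  rw [← hwp t (by omega), show Fin.ofNat (N + 1) t = t from Fin.ext (Nat.mod_eq_of_lt t.isLt)]

theorem roomWalk_inj {ℓ N s : ℕ} (hN : s + ℓ + 1 ≤ N) {p p' : Fin (ℓ + 1) → Vertex r}
    {i j : Fin α} (h : ∀ t : Fin (N + 1), roomWalk s p i j t = roomWalk s p' i j t) : p = p' := by
  funext k
  have hk := h ⟨s + 1 + k, by omega⟩
  simpa only [roomWalk_add, Sum.inl.injEq] using hk

theorem IsPath.prod_fin_roomMatrix {ℓ N : ℕ} {p : Fin (ℓ + 1) → Vertex r} (hp : IsPath r ℓ p)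
    {i j : Fin α} (hℓ : s i + ℓ = e j) (hN : e j + 2 ≤ N) :
    ∏ t : Fin N, roomMatrix r y s e (0 + t) (roomWalk (s i) p i j t.castSucc)
      (roomWalk (s i) p i j t.succ) = pathWeight r y p := by
  rw [← hp.prod_roomMatrix hℓ hN, Finset.prod_range]
  simp only [zero_add, Fin.val_castSucc, Fin.val_succ]

theorem transferProd_roomMatrix (hse : ∀ i j, s i ≤ e j) (i j : Fin α) {N : ℕ}
    (hN : e j + 2 ≤ N) :
    transferProd (roomMatrix r y s e) 0 N (Sum.inr i) (Sum.inr j) =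
      (adjacency r y ^ (e j - s i)) (Sum.inl 0) (Sum.inl 0) := by
  classical
  have hij := hse i j
  rw [transferProd_apply_eq_sum, adjacency_pow_eq_sum]
  symm
  refine Finset.sum_of_injOn (fun p t => roomWalk (s i) p i j t) (fun p _ p' _ h => ?_)
    (fun p _ => ?_) (fun w hw hwp => ?_) fun p hp => ?_
  · exact roomWalk_inj (by omega) (congrFun h)
  · simp only [Finset.coe_filter_univ, Set.mem_ofPred_eq]
    exact ⟨roomWalk_of_le p i j (Nat.zero_le _), roomWalk_of_lt p i j (by simp; omega)⟩
  · by_contra hne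
    rw [← ne_eq, Finset.prod_ne_zero_iff] at hne
    simp only [Finset.mem_filter_univ] at hw
    obtain ⟨p, hp, hwp'⟩ := exists_isPath_of_roomStep (fun t => roomStep_of_roomMatrix_ne_zero
      (by simpa using hne t (Finset.mem_univ t))) hse hw.1 hw.2 hN
    exact hwp ⟨p, by simpa using hp, (funext hwp').symm⟩
  · exact (((Finset.mem_filter_univ p).mp hp).prod_fin_roomMatrix (by omega) hN).symm

theorem injective_roomWalk_iff {N : ℕ} (hse : ∀ i, s i ≤ e i) (hN : ∀ i, e i + 2 ≤ N)
    (p : ∀ i : Fin α, Fin (e i - s i + 1) → Vertex r) :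
    (∀ t : Fin (N + 1), Function.Injective fun i => roomWalk (s i) (p i) i i t) ↔
      ∀ i j, i ≠ j → ∀ (a : Fin (e i - s i + 1)) (b : Fin (e j - s j + 1)),
        s i + (a : ℕ) = s j + (b : ℕ) → p i a ≠ p j b := by
  refine ⟨fun h i j hij a b hab hpab => hij (h ⟨s i + 1 + a, ?_⟩ ?_), fun h t i j hij => ?_⟩
  · have := hse i
    have := hN i
    omega
  · have hb := roomWalk_add (s j) (p j) j j b
    rw [show s j + 1 + (b : ℕ) = s i + 1 + a by omega] at hb
    simp only [roomWalk_add, hb, hpab]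
  · by_contra hne
    have hcases (i : Fin α) : roomWalk (s i) (p i) i i t = Sum.inr i ∨
        ∃ a : Fin (e i - s i + 1), (t : ℕ) = s i + 1 + a := by
      by_cases ht : (t : ℕ) ≤ s i ∨ s i + (e i - s i) + 1 < t
      · exact .inl (ht.elim (roomWalk_of_le _ i i) (roomWalk_of_lt _ i i))
      · exact .inr ⟨⟨t - (s i + 1), by omega⟩, by simp only; omega⟩
    simp only at hij
    rcases hcases i with hi | ⟨a, ha⟩ <;> rcases hcases j with hj | ⟨b, hb⟩
    · rw [hi, hj] at hij
      exact hne (Sum.inr_injective hij)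
    · rw [hi, hb, roomWalk_add] at hij
      exact Sum.inr_ne_inl hij
    · rw [hj, ha, roomWalk_add] at hij
      exact Sum.inl_ne_inr hij
    · refine h i j hne a b (by omega) ?_
      rw [ha, roomWalk_add, ← ha, hb, roomWalk_add] at hij
      exact Sum.inl_injective hij

theorem pathPartition_eq_disjointWalkSum (hse : ∀ i j, s i ≤ e j) {N : ℕ}
    (hN : ∀ i, e i + 2 ≤ N) :
    pathPartition r y s e = disjointWalkSum (roomMatrix r y s e) 0 N Sum.inr Sum.inr := by
  classical
  refine Finset.sum_of_injOn (fun p t i => roomWalk (s i) (p i) i i t) (fun p _ p' _ h => ?_)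
    (fun p hp => ?_) (fun q hq hqp => ?_) fun p hp => ?_
  · funext i
    have := hse i i
    have := hN i
    exact roomWalk_inj (N := N) (by omega) fun t => congrFun (congrFun h t) i
  · simp only [Finset.coe_filter_univ, Set.mem_ofPred_eq] at hp ⊢
    refine ⟨funext fun i => roomWalk_of_le _ i i (Nat.zero_le _),
      funext fun i => roomWalk_of_lt _ i i ?_,
      (injective_roomWalk_iff (fun i => hse i i) hN p).mpr hp.2.2⟩
    have := hse i i
    have := hN i
    rw [Fin.val_last]
    omega
  · by_contra hne
    simp only [← ne_eq, Finset.prod_ne_zero_iff] at hne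
    simp only [Finset.mem_filter_univ] at hq
    have hpath (i : Fin α) := exists_isPath_of_roomStep (w := fun t => q t i)
      (fun t => roomStep_of_roomMatrix_ne_zero
        (by simpa using hne t (Finset.mem_univ t) i (Finset.mem_univ i)))
      hse (congrFun hq.1 i) (congrFun hq.2.1 i) (hN i)
    choose p hp hqp' using hpath
    have hq_eq : (fun (t : Fin (N + 1)) i => roomWalk (s i) (p i) i i t) = q :=
      funext₂ fun t i => (hqp' i t).symm
    refine hqp ⟨p, ?_, hq_eq⟩
    simp only [Finset.coe_filter_univ, Set.mem_ofPred_eq]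
    exact ⟨fun i => hse i i, hp, (injective_roomWalk_iff (fun i => hse i i) hN p).mp
      fun t => congrFun hq_eq t ▸ hq.2.2 t⟩
  · have hp' := (Finset.mem_filter_univ p).mp hp
    rw [Finset.prod_comm]
    exact Finset.prod_congr rfl fun i _ =>
      ((hp'.2.1 i).prod_fin_roomMatrix (Nat.add_sub_cancel' (hse i i)) (hN i)).symm

theorem pathPartition_eq_det {c : ℕ} (hs : StrictMono s) (he : StrictAnti e)
    (hse : ∀ i j, s i ≤ e j) (hc : ∀ i, s i % 2 = c) :
    pathPartition r y s e =
      (Matrix.of fun i j => (adjacency r y ^ (e j - s i)) (Sum.inl 0) (Sum.inl 0)).det := by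
  obtain ⟨N, hN⟩ : ∃ N, ∀ i, e i + 2 ≤ N :=
    ⟨Finset.univ.sup e + 2, fun i => by grw [← Finset.le_sup (Finset.mem_univ i)]⟩
  rw [pathPartition_eq_disjointWalkSum hse hN, ← det_transferProd_eq_disjointWalkSum
    (t := 0) (v := Sum.inr) (b := Sum.inr) (lt := RoomLT c) (fun _ _ _ => RoomLT.asymm)
    (roomMatrix r y s e) (fun _ _ _ _ _ h ha hb => h.eq_or_roomLT hs he hse hc
      (roomStep_of_roomMatrix_ne_zero ha) (roomStep_of_roomMatrix_ne_zero hb)) N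
    (fun _ _ hij => hij) fun _ _ hij => hij]
  exact congrArg det (ext fun i j => transferProd_roomMatrix hse i j (hN j))

end NonIntersectingPaths

section QuotientDifference

variable {A : Type*} [CommRing A]

/-- The total weight of the walks of `n` steps from the vertex `k + 1` to the vertex `0` of a chain
`0, 1, 2, …` with a loop of two steps at each positive vertex: away from `0` the steps have weight
`1`, the step `k + 2 → k + 1` has weight `e k`, the loop at `k + 2` has weight `q (k + 1)`, and the
step `1 → 0`, the second half of a loop at `1`, has weight `q 0`. -/
def chainWalkSum (q e : ℕ → A) : ℕ → ℕ → A
  | 0, _ => 0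
  | 1, 0 => q 0
  | 1, _ + 1 => 0
  | n + 2, 0 => chainWalkSum q e (n + 1) 1 + q 0 * chainWalkSum q e n 0
  | n + 2, k + 1 => chainWalkSum q e (n + 1) (k + 2) + q (k + 1) * chainWalkSum q e n (k + 1) +
      e k * chainWalkSum q e (n + 1) k

theorem chainWalkSum_eq_zero {q e : ℕ → A} {r : ℕ} (hq : ∀ k, r < k → q k = 0)
    (he : ∀ k, r ≤ k → e k = 0) (n : ℕ) {k : ℕ} (hk : r < k) : chainWalkSum q e n k = 0 := by
  obtain ⟨k, rfl⟩ := Nat.exists_eq_succ_of_ne_zero (Nat.ne_zero_of_lt hk)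
  induction n using Nat.twoStepInduction generalizing k with
  | zero => rfl
  | one => rfl
  | more n _ ih =>
    rw [chainWalkSum, ih (k + 1) (by omega), hq _ hk, he k (by omega)]
    ring

/-- The hypotheses are the rhombus rules of the quotient-difference algorithm for T-fractions, which
describe how the coefficients of the fraction change when the first moment is dropped. -/
theorem chainWalkSum_of_rhombus_rules {q e q' e' : ℕ → A} (h_zero : q 0 = q' 0 + e' 0)
    (h_add : ∀ k, q (k + 1) + e k = q' (k + 1) + e' (k + 1))
    (h_mul : ∀ k, q (k + 1) * e' k = q' k * e k) (n k : ℕ) :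
    chainWalkSum q' e' (n + 1) (k + 1) + q' k * chainWalkSum q' e' n k =
      q' 0 * chainWalkSum q e n k := by
  induction n using Nat.twoStepInduction generalizing k with
  | zero => simp only [chainWalkSum, mul_zero, add_zero]
  | one =>
    cases k with
    | zero => linear_combination (norm := (simp only [chainWalkSum]; ring)) -q' 0 * h_zero
    | succ k => simp only [chainWalkSum, mul_zero, add_zero]
  | more n ih ih' =>
    cases k with
    | zero =>
      linear_combination (norm := (simp only [chainWalkSum]; ring))
        ih' 1 + q 0 * ih 0 - chainWalkSum q' e' (n + 2) 0 * h_zero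
    | succ k =>
      linear_combination (norm := (simp only [chainWalkSum]; ring))
        ih' (k + 2) + q (k + 1) * ih (k + 1) + e k * ih' k
          - chainWalkSum q' e' (n + 2) (k + 1) * h_add k + chainWalkSum q' e' (n + 1) k * h_mul k

theorem chainWalkSum_zero_of_rhombus_rules {q e q' e' : ℕ → A} (h_zero : q 0 = q' 0 + e' 0)
    (h_add : ∀ k, q (k + 1) + e k = q' (k + 1) + e' (k + 1))
    (h_mul : ∀ k, q (k + 1) * e' k = q' k * e k) (n : ℕ) :
    chainWalkSum q' e' (n + 2) 0 = q' 0 * chainWalkSum q e n 0 := by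
  rw [chainWalkSum, chainWalkSum_of_rhombus_rules h_zero h_add h_mul]

end QuotientDifference

section Adjacency

variable {K : Type*} [Field K] {r : ℕ} {y : ℕ → K}

theorem sum_ite_val_eq {M : Type*} [AddCommMonoid M] {N : ℕ} (f : Fin N → M) (j : ℕ) :
    ∑ w : Fin N, (if (w : ℕ) = j then f w else 0) = if h : j < N then f ⟨j, h⟩ else 0 := by
  split_ifs with h
  · rw [Finset.sum_eq_single ⟨j, h⟩ (fun w _ hw => if_neg fun hwj => hw (Fin.ext hwj)) (by simp),
      if_pos rfl]
  · exact Finset.sum_eq_zero fun w _ => if_neg (by omega)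

variable (f : Vertex r → K)

theorem adjacency_mulVec_inl {k : ℕ} (hk : k < r + 3) :
    (adjacency r y *ᵥ f) (Sum.inl ⟨k, hk⟩) =
      (if h : k + 1 < r + 3 then f (Sum.inl ⟨k + 1, h⟩) else 0) +
      (if h : 1 ≤ k then y (chainLabel r (k - 1)) * f (Sum.inl ⟨k - 1, by omega⟩) else 0) +
      (if h : 2 ≤ k ∧ k ≤ r then f (Sum.inr ⟨k - 2, by omega⟩) else 0) := by
  have hinl (w : Fin (r + 3)) : adjacency r y (Sum.inl ⟨k, hk⟩) (Sum.inl w) * f (Sum.inl w) =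
      (if (w : ℕ) = k + 1 then f (Sum.inl w) else 0) +
        if (w : ℕ) = k - 1 then
          if 1 ≤ k then y (chainLabel r (k - 1)) * f (Sum.inl w) else 0
        else 0 := by
    simp only [adjacency, of_apply, Arrow, edgeWeight]
    grind
  have hinr (w : Fin (r - 1)) : adjacency r y (Sum.inl ⟨k, hk⟩) (Sum.inr w) * f (Sum.inr w) =
      if (w : ℕ) = k - 2 then if 2 ≤ k then f (Sum.inr w) else 0 else 0 := by
    simp only [adjacency, of_apply, Arrow, edgeWeight]
    grind
  simp only [mulVec, dotProduct, Fintype.sum_sum_type, hinl, hinr, Finset.sum_add_distrib,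
    sum_ite_val_eq]
  grind

theorem adjacency_mulVec_inr (k : Fin (r - 1)) :
    (adjacency r y *ᵥ f) (Sum.inr k) =
      y (2 * ((k : ℕ) + 2) - 1) * f (Sum.inl ⟨k + 2, by omega⟩) := by
  rw [mulVec, dotProduct, Finset.sum_eq_single (Sum.inl ⟨k + 2, by omega⟩) _ (by simp)]
  · simp [adjacency, Arrow, edgeWeight]
  · rintro (w | w) _ hw
    · have : ¬(w : ℕ) = k + 2 := fun h => hw (congrArg _ (Fin.ext h))
      simp [adjacency, Arrow, this]
    · simp [adjacency, Arrow]

end Adjacency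

section ChainWalks

variable {K : Type*} [Field K] {r : ℕ} {y : ℕ → K}

theorem adjacency_pow_succ_apply (n : ℕ) (v w : Vertex r) :
    (adjacency r y ^ (n + 1)) v w = (adjacency r y *ᵥ fun u => (adjacency r y ^ n) u w) v := by
  rw [pow_succ', mul_apply]
  rfl

theorem adjacency_pow_succ_zero (n : ℕ) :
    (adjacency r y ^ (n + 1)) (Sum.inl 0) (Sum.inl 0) =
      (adjacency r y ^ n) (Sum.inl 1) (Sum.inl 0) := by
  have h := adjacency_mulVec_inl (y := y) (fun u => (adjacency r y ^ n) u (Sum.inl 0))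
    (Nat.succ_pos (r + 2))
  rw [adjacency_pow_succ_apply]
  simpa using h

theorem adjacency_pow_add_two (n : ℕ) {k : ℕ} (hk : k < r) :
    (adjacency r y ^ (n + 2)) (Sum.inl ⟨k + 2, by omega⟩) (Sum.inl 0) =
      (if h : k + 2 ≤ r then
        (adjacency r y ^ (n + 1)) (Sum.inl ⟨k + 3, by omega⟩) (Sum.inl 0) else 0) +
      y (2 * k + 3) * (adjacency r y ^ n) (Sum.inl ⟨k + 2, by omega⟩) (Sum.inl 0) +
      y (2 * k + 2) * (adjacency r y ^ (n + 1)) (Sum.inl ⟨k + 1, by omega⟩) (Sum.inl 0) := by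
  have hstep : chainLabel r (k + 1) = 2 * k + 2 := by grind [chainLabel]
  rw [adjacency_pow_succ_apply, adjacency_mulVec_inl, dif_pos (by omega), dif_pos (by omega)]
  simp only [Nat.add_sub_cancel, show k + 2 - 1 = k + 1 from rfl, hstep]
  rcases Nat.lt_or_ge (k + 1) r with hkr | hkr
  · rw [dif_pos ⟨by omega, hkr⟩, dif_pos (show k + 2 ≤ r from hkr),
      adjacency_pow_succ_apply n (Sum.inr _),
      adjacency_mulVec_inr]
    simp only [show 2 * (k + 2) - 1 = 2 * k + 3 by omega]
    ring
  · obtain rfl : r = k + 1 := by omega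
    have hlast : chainLabel (k + 1) (k + 2) = 2 * k + 3 := by grind [chainLabel]
    rw [dif_neg (by omega), dif_neg (by omega), adjacency_pow_succ_apply n (Sum.inl ⟨k + 3, _⟩),
      adjacency_mulVec_inl, dif_neg (by omega), dif_pos (by omega), dif_neg (by omega)]
    simp only [show k + 3 - 1 = k + 2 from rfl, hlast]
    ring

/-- The weight `y_{2k+1}` of the loop of two steps at the vertex `k + 1` of `G̃_r`, where
`k ≤ r`. -/
def loopWeight (r : ℕ) (y : ℕ → K) (k : ℕ) : K := if k ≤ r then y (2 * k + 1) else 0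

/-- The weight `y_{2k+2}` of the step from the vertex `k + 2` to the vertex `k + 1` of `G̃_r`, where
`k < r`. -/
def stepWeight (r : ℕ) (y : ℕ → K) (k : ℕ) : K := if k < r then y (2 * k + 2) else 0

theorem adjacency_pow_eq_chainWalkSum (hr : 1 ≤ r) (n : ℕ) {k : ℕ} (hk : k ≤ r) :
    (adjacency r y ^ n) (Sum.inl ⟨k + 1, by omega⟩) (Sum.inl 0) =
      chainWalkSum (loopWeight r y) (stepWeight r y) n k := by
  induction n using Nat.twoStepInduction generalizing k with
  | zero => simp [chainWalkSum]
  | one =>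
    rw [adjacency_pow_succ_apply, adjacency_mulVec_inl]
    cases k with
    | zero => simp [chainWalkSum, one_apply, chainLabel, loopWeight]
    | succ k => simp [chainWalkSum, one_apply]
  | more n ih ih' =>
    cases k with
    | zero =>
      rw [adjacency_pow_succ_apply, adjacency_mulVec_inl, chainWalkSum, ← ih' hr,
        ← ih (Nat.zero_le r)]
      simp [chainLabel, loopWeight, adjacency_pow_succ_zero]
    | succ k =>
      have hzero : r < k + 2 → chainWalkSum (loopWeight r y) (stepWeight r y) (n + 1) (k + 2) = 0 :=
        chainWalkSum_eq_zero (fun k hk => if_neg hk.not_ge) (fun k hk => if_neg hk.not_gt) _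
      have hloop : loopWeight r y (k + 1) = y (2 * k + 3) := if_pos hk
      have hstep : stepWeight r y k = y (2 * k + 2) := if_pos hk
      rw [adjacency_pow_add_two n hk, ih hk, ih' (by omega), chainWalkSum, hloop, hstep]
      split_ifs with h
      · rw [ih' h]
      · rw [hzero (by omega)]

theorem adjacency_pow_zero_eq_chainWalkSum (hr : 1 ≤ r) (n : ℕ) :
    (adjacency r y ^ (n + 1)) (Sum.inl 0) (Sum.inl 0) =
      chainWalkSum (loopWeight r y) (stepWeight r y) n 0 := by
  rw [adjacency_pow_succ_zero]
  exact adjacency_pow_eq_chainWalkSum hr n (Nat.zero_le r)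

end ChainWalks

section FirstRow

variable {K : Type*} [Field K] {r : ℕ} {R : ℕ → ℤ → K}

theorem IsSolution.translate (hR : IsSolution r R) (t : ℤ) :
    IsSolution r fun α n => R α (n + t) where
  rel α h1 h2 n := by
    have := hR.rel α h1 h2 (n + t)
    rwa [add_right_comm, add_sub_right_comm] at this
  left n := hR.left _
  right n := hR.right _

theorem NonVanishing.translate (hnv : NonVanishing r R) (t : ℤ) :
    NonVanishing r fun α n => R α (n + t) := fun α h1 h2 n => hnv α h1 h2 (n + t)

theorem weight_two_mul_add_one (R : ℕ → ℤ → K) (k : ℕ) :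
    weight R (2 * k + 1) = R k 0 * R (k + 1) 1 / (R (k + 1) 0 * R k 1) := by
  rw [weight, if_pos (by omega), show (2 * k + 1 - 1) / 2 = k by omega,
    show (2 * k + 1 + 1) / 2 = k + 1 by omega]

theorem weight_two_mul_add_two (R : ℕ → ℤ → K) (k : ℕ) :
    weight R (2 * k + 2) = R k 0 * R (k + 2) 1 / (R (k + 1) 0 * R (k + 1) 1) := by
  rw [weight, if_neg (by omega), show (2 * k + 2) / 2 = k + 1 by omega]
  rfl

theorem IsSolution.loopWeight_add_stepWeight (hR : IsSolution r R) (hnv : NonVanishing r R) {k : ℕ}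
    (hk : k ≤ r) :
    loopWeight r (weight R) k + stepWeight r (weight R) k =
      R k 0 * R (k + 1) 2 / (R (k + 1) 1 * R k 1) := by
  have n1 := hR.ne_zero hnv (show k ≤ r + 1 by omega) 1
  have n2 := hR.ne_zero hnv (show k + 1 ≤ r + 1 by omega) 0
  have n3 := hR.ne_zero hnv (show k + 1 ≤ r + 1 by omega) 1
  rw [loopWeight, if_pos hk, weight_two_mul_add_one, stepWeight]
  split_ifs with h
  · have hrel := hR.rel (k + 1) (by omega) h 1
    simp only [add_tsub_cancel_right, sub_self, one_add_one_eq_two] at hrel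
    rw [weight_two_mul_add_two]
    field_simp
    linear_combination -R k 0 * hrel
  · obtain rfl : k = r := by omega
    simp [hR.right]

theorem IsSolution.loopWeight_translate_add_stepWeight_translate (hR : IsSolution r R)
    (hnv : NonVanishing r R) {k : ℕ} (hk : k < r) :
    loopWeight r (weight fun α n => R α (n + 1)) (k + 1) +
        stepWeight r (weight fun α n => R α (n + 1)) k =
      R (k + 1) 0 * R (k + 2) 2 / (R (k + 2) 1 * R (k + 1) 1) := by
  have n1 := hR.ne_zero hnv (show k + 1 ≤ r + 1 by omega) 1
  have n2 := hR.ne_zero hnv (show k + 1 ≤ r + 1 by omega) 2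
  have n3 := hR.ne_zero hnv (show k + 2 ≤ r + 1 by omega) 1
  have hrel := hR.rel (k + 1) (by omega) hk 1
  simp only [add_tsub_cancel_right, sub_self, one_add_one_eq_two] at hrel
  rw [loopWeight, if_pos (by omega), weight_two_mul_add_one, stepWeight, if_pos hk,
    weight_two_mul_add_two]
  simp only [zero_add, one_add_one_eq_two, add_assoc]
  field_simp
  linear_combination -R (k + 2) 2 * hrel

theorem IsSolution.loopWeight_translate_mul_stepWeight (hR : IsSolution r R)
    (hnv : NonVanishing r R) {k : ℕ} (hk : k < r) :
    loopWeight r (weight fun α n => R α (n + 1)) (k + 1) * stepWeight r (weight R) k =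
      loopWeight r (weight R) k * stepWeight r (weight fun α n => R α (n + 1)) k := by
  have n0 := hR.ne_zero hnv (show k ≤ r + 1 by omega) 1
  have n1 := hR.ne_zero hnv (show k + 1 ≤ r + 1 by omega) 1
  have n2 := hR.ne_zero hnv (show k + 2 ≤ r + 1 by omega) 1
  simp only [loopWeight, if_pos hk.le, if_pos (show k + 1 ≤ r from hk), stepWeight, if_pos hk,
    weight_two_mul_add_one, weight_two_mul_add_two, zero_add, one_add_one_eq_two, add_assoc]
  field_simp

theorem IsSolution.adjacency_pow_translate (hR : IsSolution r R) (hnv : NonVanishing r R)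
    (hr : 1 ≤ r) (n : ℕ) :
    (adjacency r (weight R) ^ (n + 2)) (Sum.inl 0) (Sum.inl 0) =
      weight R 1 * (adjacency r (weight fun α n => R α (n + 1)) ^ n) (Sum.inl 0) (Sum.inl 0) := by
  have hone : loopWeight r (weight R) 0 = weight R 1 := if_pos (Nat.zero_le r)
  rw [adjacency_pow_zero_eq_chainWalkSum hr]
  cases n with
  | zero => simp [chainWalkSum, hone]
  | succ n =>
    rw [adjacency_pow_zero_eq_chainWalkSum hr, ← hone]
    refine chainWalkSum_zero_of_rhombus_rules ?_ (fun k => ?_) (fun k => ?_) n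
    · rw [hR.loopWeight_add_stepWeight hnv (Nat.zero_le r), loopWeight, if_pos (Nat.zero_le r),
        weight_two_mul_add_one]
      simp [hR.left, one_add_one_eq_two]
    · rcases Nat.lt_or_ge k r with hk | hk
      · rw [hR.loopWeight_translate_add_stepWeight_translate hnv hk,
          hR.loopWeight_add_stepWeight hnv hk]
      · simp [loopWeight, stepWeight, hk.not_gt, show ¬k + 1 ≤ r by omega, show ¬k + 1 < r by omega]
    · rcases Nat.lt_or_ge k r with hk | hk
      · exact hR.loopWeight_translate_mul_stepWeight hnv hk
      · simp [stepWeight, hk.not_gt]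

theorem IsSolution.eq_adjacency_pow (hR : IsSolution r R) (hnv : NonVanishing r R) (hr : 1 ≤ r)
    (n : ℕ) : R 1 n = R 1 0 * (adjacency r (weight R) ^ (2 * n)) (Sum.inl 0) (Sum.inl 0) := by
  induction n generalizing R with
  | zero => simp
  | succ n ih =>
    have hw : weight R 1 = R 1 1 / R 1 0 := by simpa [hR.left] using weight_two_mul_add_one R 0
    have h := ih (hR.translate 1) (hnv.translate 1)
    rw [zero_add] at h
    rw [Nat.cast_succ, h, mul_add_one, hR.adjacency_pow_translate hnv hr, hw, ← mul_assoc,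
      mul_div_cancel₀ _ (hnv 1 le_rfl hr 0)]

theorem IsSolution.eq_pathPartition (hR : IsSolution r R) (hnv : NonVanishing r R) (hr : 1 ≤ r)
    {α n : ℕ} (hα : α ≤ r + 1) (hn : α ≤ n + 1) :
    R α n = R 1 0 ^ α * pathPartition r (weight R) (startTime α) (endTime n α) := by
  rw [pathPartition_eq_det (c := 0) (fun i j hij => by grind [startTime])
    (fun i j hij => by grind [endTime]) (fun i j => by grind [startTime, endTime])
    (fun i => by grind [startTime]), hR.eq_hankelDet hnv hα, hankelDet,
    ← det_submatrix_equiv_self Fin.revPerm]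
  refine Eq.trans (congrArg det ?_) ((det_smul _ (R 1 0)).trans (by rw [Fintype.card_fin]))
  ext i j
  simp only [submatrix_apply, of_apply, Matrix.smul_apply, smul_eq_mul, Fin.revPerm_apply]
  rw [show endTime n α j - startTime α i = 2 * (n + α - 1 - i - j) by
    unfold startTime endTime; omega, ← hR.eq_adjacency_pow hnv hr]
  congr 1
  have := Fin.val_rev i
  have := Fin.val_rev j
  omega

end FirstRow

section Laurent

variable {K : Type*} [Field K] {ι κ : Type*} [Fintype ι] [Fintype κ]

theorem laurentMonomial_zero (x : ι → K) : laurentMonomial 0 x = 1 := by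
  simp [laurentMonomial]

theorem laurentMonomial_add {x : ι → K} (hx : ∀ v, x v ≠ 0) (m m' : ι → ℤ) :
    laurentMonomial (m + m') x = laurentMonomial m x * laurentMonomial m' x := by
  simp [laurentMonomial, zpow_add₀ (hx _), Finset.prod_mul_distrib]

theorem laurentMonomial_sub {x : ι → K} (hx : ∀ v, x v ≠ 0) (m m' : ι → ℤ) :
    laurentMonomial (m - m') x = laurentMonomial m x / laurentMonomial m' x := by
  simp [laurentMonomial, zpow_sub₀ (hx _), Finset.prod_div_distrib]

theorem laurentMonomial_sum {x : ι → K} (hx : ∀ v, x v ≠ 0) {J : Type*} (s : Finset J)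
    (m : J → ι → ℤ) : laurentMonomial (∑ j ∈ s, m j) x = ∏ j ∈ s, laurentMonomial (m j) x := by
  classical
  induction s using Finset.induction_on with
  | empty => simp [laurentMonomial_zero]
  | insert j s hj ih => rw [Finset.sum_insert hj, Finset.prod_insert hj, laurentMonomial_add hx, ih]

theorem laurentMonomial_nsmul (n : ℕ) (m : ι → ℤ) (x : ι → K) :
    laurentMonomial (n • m) x = laurentMonomial m x ^ n := by
  simp [laurentMonomial, mul_comm, _root_.zpow_mul, Finset.prod_pow]

theorem PosLaurent.eval_sum_single {J : Type*} (s : Finset J) (m : J → ι → ℤ) (x : ι → K) :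
    PosLaurent.eval (∑ j ∈ s, Finsupp.single (m j) 1) x = ∑ j ∈ s, laurentMonomial (m j) x := by
  classical
  unfold PosLaurent.eval
  rw [← Finsupp.sum_finsetSum_index (by simp) (by intros; push_cast; ring)]
  refine Finset.sum_congr rfl fun j _ => ?_
  rw [Finsupp.sum_single_index (by simp)]
  simp

/-- The exponent vector of the monomial that the substitution of the variable `g u` for each
variable `u` makes of the monomial with exponent vector `m`. -/
def pushExponent (g : ι → κ) [DecidableEq κ] (m : ι → ℤ) (v : κ) : ℤ :=
  ∑ u, if g u = v then m u else 0

theorem laurentMonomial_pushExponent [DecidableEq κ] {x : κ → K} (hx : ∀ v, x v ≠ 0) (g : ι → κ)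
    (m : ι → ℤ) : laurentMonomial (pushExponent g m) x = laurentMonomial m (x ∘ g) := by
  have hsum : pushExponent g m = ∑ u, fun v => if g u = v then m u else 0 := by
    ext v
    simp [pushExponent]
  rw [hsum, laurentMonomial_sum hx]
  refine Finset.prod_congr rfl fun u _ => ?_
  rw [laurentMonomial, Finset.prod_eq_single (g u) _ (by simp)]
  · simp
  · intro v _ hv
    simp [hv.symm]

theorem PosLaurent.eval_mapDomain_pushExponent [DecidableEq κ] {x : κ → K} (hx : ∀ v, x v ≠ 0)
    (g : ι → κ) (P : PosLaurent ι) :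
    PosLaurent.eval (Finsupp.mapDomain (pushExponent g) P) x = P.eval (x ∘ g) := by
  unfold PosLaurent.eval
  rw [Finsupp.sum_mapDomain_index (by simp) (by intros; push_cast; ring)]
  simp only [laurentMonomial_pushExponent hx]

end Laurent

section LaurentExpansion

variable {K : Type*} [Field K] {r : ℕ} {R : ℕ → ℤ → K}

theorem NonVanishing.initialData_ne_zero (hnv : NonVanishing r R) (v : InitVar r) :
    initialData r R v ≠ 0 := hnv _ (by omega) (by omega) _

/-- The exponent vector of the initial variable `R α k`, `k = 0, 1`; it is zero for `α = 0` and
for `α = r + 1`, where `R α k = 1`. -/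
def initExponent (r α k : ℕ) (v : InitVar r) : ℤ :=
  if (v.1 : ℕ) + 1 = α ∧ (v.2 : ℕ) = k then 1 else 0

theorem IsSolution.laurentMonomial_initExponent (hR : IsSolution r R) {α k : ℕ} (hα : α ≤ r + 1)
    (hk : k < 2) : laurentMonomial (initExponent r α k) (initialData r R) = R α k := by
  by_cases h : 1 ≤ α ∧ α ≤ r
  · rw [laurentMonomial, Finset.prod_eq_single (⟨α - 1, by omega⟩, ⟨k, hk⟩) _ (by simp)]
    · simp [initExponent, initialData, show α - 1 + 1 = α by omega]
    · rintro ⟨a, b⟩ _ hv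
      rw [initExponent, if_neg, zpow_zero]
      rintro ⟨h1, h2⟩
      exact hv (Prod.ext (Fin.ext (by simp only at h1 ⊢; omega)) (Fin.ext h2))
  · have h0 : initExponent r α k = 0 := by
      ext v
      exact if_neg (by omega)
    rw [h0, laurentMonomial_zero]
    obtain rfl | rfl : α = 0 ∨ α = r + 1 := by omega
    · exact (hR.left _).symm
    · exact (hR.right _).symm

/-- The exponent vector of the weight `y_j` as a Laurent monomial in the initial data. -/
def weightExponent (r j : ℕ) : InitVar r → ℤ :=
  if j % 2 = 1 then
    initExponent r ((j - 1) / 2) 0 + initExponent r ((j + 1) / 2) 1 -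
      (initExponent r ((j + 1) / 2) 0 + initExponent r ((j - 1) / 2) 1)
  else
    initExponent r (j / 2 - 1) 0 + initExponent r (j / 2 + 1) 1 -
      (initExponent r (j / 2) 0 + initExponent r (j / 2) 1)

theorem IsSolution.weight_eq (hR : IsSolution r R) (hnv : NonVanishing r R) {j : ℕ}
    (hj : j ≤ 2 * r + 1) :
    weight R j = laurentMonomial (weightExponent r j) (initialData r R) := by
  have hx := hnv.initialData_ne_zero
  have h0 : ∀ α ≤ r + 1, laurentMonomial (initExponent r α 0) (initialData r R) = R α 0 :=
    fun α hα => hR.laurentMonomial_initExponent hα two_pos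
  have h1 : ∀ α ≤ r + 1, laurentMonomial (initExponent r α 1) (initialData r R) = R α 1 :=
    fun α hα => hR.laurentMonomial_initExponent hα one_lt_two
  unfold weight weightExponent
  split_ifs <;>
    rw [laurentMonomial_sub hx, laurentMonomial_add hx, laurentMonomial_add hx, h0 _ (by omega),
      h1 _ (by omega), h0 _ (by omega), h1 _ (by omega)]

/-- The exponent vector of the weight of an oriented edge of `G̃_r`. -/
def edgeExponent (r : ℕ) : Vertex r → Vertex r → InitVar r → ℤ
  | Sum.inl a, Sum.inl b => if (a : ℕ) < b then 0 else weightExponent r (chainLabel r b)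
  | Sum.inr a, Sum.inl _ => weightExponent r (2 * ((a : ℕ) + 2) - 1)
  | _, _ => 0

theorem chainLabel_le (r k : ℕ) : chainLabel r k ≤ 2 * r + 1 := by
  grind [chainLabel]

theorem IsSolution.edgeWeight_eq (hR : IsSolution r R) (hnv : NonVanishing r R) (a b : Vertex r) :
    edgeWeight r (weight R) a b = laurentMonomial (edgeExponent r a b) (initialData r R) := by
  rcases a with a | a <;> rcases b with b | b
  · simp only [edgeWeight, edgeExponent]
    split_ifs
    · rw [laurentMonomial_zero]
    · exact hR.weight_eq hnv (chainLabel_le r b)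
  · simp [edgeWeight, edgeExponent, laurentMonomial_zero]
  · exact hR.weight_eq hnv (by omega)
  · simp [edgeWeight, edgeExponent, laurentMonomial_zero]

open Classical in
/-- The Laurent polynomial `R_{1,0}^α Z_{α,n}` in the initial data: one monomial for each family of
non-intersecting paths. -/
noncomputable def pathLaurent (r α n : ℕ) : PosLaurent (InitVar r) :=
  ∑ p : (∀ i : Fin α, Fin (endTime n α i - startTime α i + 1) → Vertex r) with
      IsNonIntersectingFamily r (startTime α) (endTime n α) p,
    Finsupp.single (α • initExponent r 1 0 +
      ∑ i, ∑ t : Fin (endTime n α i - startTime α i),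
        edgeExponent r (p i t.castSucc) (p i t.succ)) 1

theorem IsSolution.eq_eval_pathLaurent (hR : IsSolution r R) (hnv : NonVanishing r R) (hr : 1 ≤ r)
    {α n : ℕ} (hα : α ≤ r + 1) (hn : α ≤ n + 1) :
    R α n = (pathLaurent r α n).eval (initialData r R) := by
  classical
  have hx := hnv.initialData_ne_zero
  rw [hR.eq_pathPartition hnv hr hα hn, pathLaurent, PosLaurent.eval_sum_single, pathPartition,
    Finset.mul_sum]
  refine Finset.sum_congr rfl fun p _ => ?_
  rw [laurentMonomial_add hx, laurentMonomial_nsmul,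
    hR.laurentMonomial_initExponent (by omega) two_pos, laurentMonomial_sum hx]
  refine congrArg₂ _ rfl (Finset.prod_congr rfl fun i _ => ?_)
  rw [laurentMonomial_sum hx, pathWeight]
  exact Finset.prod_congr rfl fun t _ => hR.edgeWeight_eq hnv _ _

end LaurentExpansion

section Specialization

variable {F K : Type*} [Field F] [Field K] {ι : Type*} {x : ι → F} {y : ι → K}

/-- The pairs `(f x, f y)` for the rational functions `f = p / q` with integer coefficients whose
denominator does not vanish at `y`; when `x` is algebraically independent, they form the graph of
the specialization `x ↦ y`. -/
def specializations (x : ι → F) (y : ι → K) : Subring (F × K) where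
  carrier := {z | ∃ p q : MvPolynomial ι ℤ, MvPolynomial.aeval y q ≠ 0 ∧
    z.1 * MvPolynomial.aeval x q = MvPolynomial.aeval x p ∧
    z.2 * MvPolynomial.aeval y q = MvPolynomial.aeval y p}
  zero_mem' := ⟨0, 1, by simp⟩
  one_mem' := ⟨1, 1, by simp⟩
  add_mem' := by
    rintro z w ⟨p, q, hq, hzx, hzy⟩ ⟨p', q', hq', hwx, hwy⟩
    refine ⟨p * q' + p' * q, q * q', by simp [hq, hq'], ?_, ?_⟩
    · simp only [map_mul, map_add, ← hzx, ← hwx, Prod.fst_add]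
      ring
    · simp only [map_mul, map_add, ← hzy, ← hwy, Prod.snd_add]
      ring
  neg_mem' := by
    rintro z ⟨p, q, hq, hzx, hzy⟩
    exact ⟨-p, q, hq, by simp [hzx], by simp [hzy]⟩
  mul_mem' := by
    rintro z w ⟨p, q, hq, hzx, hzy⟩ ⟨p', q', hq', hwx, hwy⟩
    refine ⟨p * p', q * q', by simp [hq, hq'], ?_, ?_⟩
    · simp only [map_mul, ← hzx, ← hwx, Prod.fst_mul]
      ring
    · simp only [map_mul, ← hzy, ← hwy, Prod.snd_mul]
      ring

theorem mk_mem_specializations (x : ι → F) (y : ι → K) (v : ι) :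
    (x v, y v) ∈ specializations x y :=
  ⟨MvPolynomial.X v, 1, by simp⟩

theorem fst_ne_zero_of_mem_specializations (hx : AlgebraicIndependent ℤ x) {z : F × K}
    (hz : z ∈ specializations x y) (hne : z.2 ≠ 0) : z.1 ≠ 0 := by
  obtain ⟨p, q, hq, hzx, hzy⟩ := hz
  intro h
  rw [h, zero_mul, eq_comm, ← map_zero (MvPolynomial.aeval (R := ℤ) x)] at hzx
  rw [hx hzx, map_zero] at hzy
  exact mul_ne_zero hne hq hzy

theorem snd_eq_of_mem_specializations (hx : AlgebraicIndependent ℤ x) {a : F} {b c : K}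
    (hb : (a, b) ∈ specializations x y) (hc : (a, c) ∈ specializations x y) : b = c := by
  by_contra hbc
  have hsub := sub_mem hb hc
  exact fst_ne_zero_of_mem_specializations hx hsub (sub_ne_zero.mpr hbc) (sub_self a)

theorem inv_mem_specializations (hx : AlgebraicIndependent ℤ x) {z : F × K}
    (hz : z ∈ specializations x y) (hne : z.2 ≠ 0) : z⁻¹ ∈ specializations x y := by
  have hne' := fst_ne_zero_of_mem_specializations hx hz hne
  obtain ⟨p, q, hq, hzx, hzy⟩ := hz
  refine ⟨q, p, hzy ▸ mul_ne_zero hne hq, ?_, ?_⟩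
  · rw [← hzx, Prod.fst_inv, inv_mul_cancel_left₀ hne']
  · rw [← hzy, Prod.snd_inv, inv_mul_cancel_left₀ hne]

theorem div_mem_specializations (hx : AlgebraicIndependent ℤ x) {z w : F × K}
    (hz : z ∈ specializations x y) (hw : w ∈ specializations x y) (hne : w.2 ≠ 0) :
    z / w ∈ specializations x y :=
  div_eq_mul_inv z w ▸ mul_mem hz (inv_mem_specializations hx hw hne)

theorem zpow_mem_specializations (hx : AlgebraicIndependent ℤ x) {z : F × K}
    (hz : z ∈ specializations x y) (hne : z.2 ≠ 0) (n : ℤ) : z ^ n ∈ specializations x y := by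
  cases n with
  | ofNat n => simpa using pow_mem hz n
  | negSucc n =>
    rw [zpow_negSucc]
    exact inv_mem_specializations hx (pow_mem hz (n + 1)) (pow_ne_zero _ hne)

theorem PosLaurent.eval_mem_specializations [Fintype ι] (hx : AlgebraicIndependent ℤ x)
    (hy : ∀ v, y v ≠ 0) (P : PosLaurent ι) : (P.eval x, P.eval y) ∈ specializations x y := by
  have heval : (P.eval x, P.eval y) =
      P.sum fun m c => (c : F × K) * ∏ v, ((x v, y v) : F × K) ^ m v := by
    ext <;> simp [PosLaurent.eval, Finsupp.sum, laurentMonomial, Prod.fst_sum, Prod.snd_sum,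
      Prod.fst_prod, Prod.snd_prod]
  rw [heval]
  exact sum_mem fun m _ => mul_mem (natCast_mem _ _) <| prod_mem fun v _ =>
    zpow_mem_specializations hx (mk_mem_specializations x y v) (hy v) _

end Specialization

section Recursion

variable {F K : Type*} [Field F] [Field K] {r : ℕ}

/-- The forward recursion of the `Q`-system: `evolve x n α` is the value at `(α, n)`, `n ≥ 0`, of
the solution with initial data `x`, as long as no denominator vanishes. It is `1` unless
`1 ≤ α ≤ r`. -/
noncomputable def evolve (x : InitVar r → K) : ℕ → ℕ → K
  | 0, α => if h : 1 ≤ α ∧ α ≤ r then x (⟨α - 1, by omega⟩, 0) else 1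
  | 1, α => if h : 1 ≤ α ∧ α ≤ r then x (⟨α - 1, by omega⟩, 1) else 1
  | n + 2, α =>
    if 1 ≤ α ∧ α ≤ r then
      (evolve x (n + 1) α ^ 2 + evolve x (n + 1) (α + 1) * evolve x (n + 1) (α - 1)) /
        evolve x n α
    else 1

theorem evolve_of_not_mem (x : InitVar r → K) (n : ℕ) {α : ℕ} (hα : ¬(1 ≤ α ∧ α ≤ r)) :
    evolve x n α = 1 := by
  match n with
  | 0 | 1 => exact dif_neg hα
  | n + 2 => exact if_neg hα

theorem evolve_initVar (x : InitVar r → K) (v : InitVar r) : evolve x v.2 (v.1 + 1) = x v := by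
  obtain ⟨i, k⟩ := v
  fin_cases k <;> exact dif_pos ⟨by simp, i.isLt⟩

theorem evolve_add_two (x : InitVar r → K) (n : ℕ) {α : ℕ} (h1 : 1 ≤ α) (hα : α ≤ r) :
    evolve x (n + 2) α =
      (evolve x (n + 1) α ^ 2 + evolve x (n + 1) (α + 1) * evolve x (n + 1) (α - 1)) /
        evolve x n α :=
  if_pos ⟨h1, hα⟩

theorem evolve_mul_evolve {x : InitVar r → K} {n α : ℕ} (h1 : 1 ≤ α) (hα : α ≤ r)
    (hne : evolve x n α ≠ 0) :
    evolve x (n + 2) α * evolve x n α =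
      evolve x (n + 1) α ^ 2 + evolve x (n + 1) (α + 1) * evolve x (n + 1) (α - 1) := by
  rw [evolve_add_two x n h1 hα, div_mul_cancel₀ _ hne]

theorem evolve_one_pos (n α : ℕ) : 0 < evolve (fun _ : InitVar r => (1 : ℚ)) n α := by
  induction n using Nat.twoStepInduction generalizing α with
  | zero | one => simp [evolve]
  | more n ih ih' =>
    by_cases hα : 1 ≤ α ∧ α ≤ r
    · have h := ih α
      have hmid := ih' α
      have hnext := ih' (α + 1)
      have hprev := ih' (α - 1)
      rw [evolve_add_two _ _ hα.1 hα.2]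
      positivity
    · rw [evolve_of_not_mem _ _ hα]
      exact one_pos

theorem IsSolution.eq_evolve {R : ℕ → ℤ → K} (hR : IsSolution r R) {n : ℕ}
    (hne : ∀ m < n, ∀ α, 1 ≤ α → α ≤ r → R α m ≠ 0) {α : ℕ} (hα : α ≤ r + 1) :
    R α n = evolve (initialData r R) n α := by
  induction n using Nat.strong_induction_on generalizing α with
  | _ n ih =>
    by_cases h : 1 ≤ α ∧ α ≤ r
    · match n with
      | 0 | 1 => simp [evolve, h, initialData]
      | n + 2 =>
        have ih' : ∀ m < n + 2, ∀ β ≤ r + 1, R β m = evolve (initialData r R) m β :=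
          fun m hm β hβ => ih m hm (fun l hl => hne l (hl.trans hm)) hβ
        have hcur := hne n (by omega) α h.1 h.2
        have hrel := hR.rel α h.1 h.2 (n + 1 : ℕ)
        rw [evolve_add_two _ _ h.1 h.2, ← ih' n (by omega) α hα, ← ih' (n + 1) (by omega) α hα,
          ← ih' (n + 1) (by omega) (α + 1) (by omega), ← ih' (n + 1) (by omega) (α - 1) (by omega),
          eq_div_iff hcur, ← hrel]
        congr 2
        push_cast
        ring
    · rw [evolve_of_not_mem _ _ h]
      obtain rfl | rfl : α = 0 ∨ α = r + 1 := by omega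
      · exact hR.left _
      · exact hR.right _

theorem NonVanishing.evolve_ne_zero {R : ℕ → ℤ → K} (hnv : NonVanishing r R)
    (hR : IsSolution r R) (n α : ℕ) : evolve (initialData r R) n α ≠ 0 := by
  by_cases h : 1 ≤ α ∧ α ≤ r
  · rw [← hR.eq_evolve (fun m _ α h1 hα => hnv α h1 hα m) (by omega)]
    exact hnv α h.1 h.2 n
  · rw [evolve_of_not_mem _ _ h]
    exact one_ne_zero

/-- The inclusion of the variables of the system of rank `r - k`, with the index `α` raised by
`k`. -/
def shiftVar (r k : ℕ) (v : InitVar (r - k)) : InitVar r := (⟨v.1 + k, by omega⟩, v.2)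

/-- Since `R α n` only depends on the initial data `R β m` with `|β - α| < max n 1`, the system of
rank `r` looks like the one of rank `r - k` as long as this light cone stays to the right of `k`. -/
theorem evolve_mem_specializations {k : ℕ} (hk : k ≤ r) {x : InitVar (r - k) → F}
    (hx : AlgebraicIndependent ℤ x) {y : InitVar r → K} (hy : ∀ n α, evolve y n α ≠ 0) (n : ℕ)
    {β : ℕ} (hβ : β ≤ r - k + 1) (hcone : k = 0 ∨ 1 ≤ β ∧ n ≤ β) :
    (evolve x n β, evolve y n (β + k)) ∈ specializations x (y ∘ shiftVar r k) := by
  induction n using Nat.strong_induction_on generalizing β with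
  | _ n ih =>
    by_cases h : 1 ≤ β ∧ β ≤ r - k
    · match n with
      | 0 | 1 =>
        have hβk : 1 ≤ β + k ∧ β + k ≤ r := by omega
        convert mk_mem_specializations x (y ∘ shiftVar r k) (⟨β - 1, by omega⟩, _) using 2
        · exact dif_pos h
        · simp [evolve, hβk, shiftVar, Nat.sub_add_comm h.1]
      | n + 2 =>
        have hcur := ih n (by omega) hβ (by omega)
        have hmid := ih (n + 1) (by omega) hβ (by omega)
        have hnext := ih (n + 1) (by omega) (β := β + 1) (by omega) (by omega)
        have hprev := ih (n + 1) (by omega) (β := β - 1) (by omega) (by omega)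
        rw [show β + 1 + k = β + k + 1 by omega] at hnext
        rw [show β - 1 + k = β + k - 1 by omega] at hprev
        rw [evolve_add_two x n h.1 h.2, evolve_add_two y n (by omega) (by omega)]
        exact div_mem_specializations hx
          (add_mem (pow_mem hmid 2) (mul_mem hnext hprev)) hcur (hy _ _)
    · rw [evolve_of_not_mem x n h, evolve_of_not_mem y n (by omega)]
      exact one_mem _

theorem evolve_ne_zero_of_algebraicIndependent {x : InitVar r → K}
    (hx : AlgebraicIndependent ℤ x) (n α : ℕ) : evolve x n α ≠ 0 := by
  by_cases hα : α ≤ r + 1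
  · have hpos := evolve_one_pos (r := r)
    exact fst_ne_zero_of_mem_specializations hx
      (evolve_mem_specializations (Nat.zero_le r) hx (fun n α => (hpos n α).ne') n hα (.inl rfl))
      (hpos n α).ne'
  · rw [evolve_of_not_mem _ _ (by omega)]
    exact one_ne_zero

end Recursion

section TimeReversal

variable {r : ℕ}

/-- The permutation of the variables that exchanges `R α 0` and `R α 1`. -/
def reverseVar (v : InitVar r) : InitVar r := (v.1, v.2.rev)

theorem reverseVar_injective : Function.Injective (reverseVar (r := r)) :=
  Function.injective_id.prodMap Fin.rev_injective

theorem initialData_reverse {K : Type*} (R : ℕ → ℤ → K) :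
    (initialData r fun α n => R α (1 - n)) = initialData r R ∘ reverseVar := by
  ext ⟨i, k⟩
  fin_cases k <;> simp [initialData, reverseVar]

variable {K : Type*} [Field K] {R : ℕ → ℤ → K}

theorem IsSolution.reverse (hR : IsSolution r R) : IsSolution r fun α n => R α (1 - n) where
  rel α h1 hα n := by
    have hrel := hR.rel α h1 hα (1 - n)
    rw [show 1 - n + 1 = 1 - (n - 1) by ring, show 1 - n - 1 = 1 - (n + 1) by ring] at hrel
    rw [mul_comm, hrel]
  left n := hR.left _
  right n := hR.right _

theorem NonVanishing.reverse (hnv : NonVanishing r R) :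
    NonVanishing r fun α n => R α (1 - n) := fun α h1 hα n => hnv α h1 hα (1 - n)

theorem IsSolution.ne_zero_of_algebraicIndependent (hR : IsSolution r R)
    (hx : AlgebraicIndependent ℤ (initialData r R)) (n : ℕ) {α : ℕ} (hα : α ≤ r + 1) :
    R α n ≠ 0 := by
  induction n using Nat.strong_induction_on generalizing α with
  | _ n ih =>
    rw [hR.eq_evolve (fun m hm β _ hβ => ih m hm (by omega)) hα]
    exact evolve_ne_zero_of_algebraicIndependent hx n α

theorem IsSolution.nonVanishing (hR : IsSolution r R)
    (hx : AlgebraicIndependent ℤ (initialData r R)) : NonVanishing r R := by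
  intro α _ hα n
  rcases le_total 0 n with hn | hn
  · lift n to ℕ using hn
    exact hR.ne_zero_of_algebraicIndependent hx n (by omega)
  · have hx' : AlgebraicIndependent ℤ (initialData r fun α n => R α (1 - n)) :=
      initialData_reverse R ▸ hx.comp _ reverseVar_injective
    have hne := hR.reverse.ne_zero_of_algebraicIndependent hx' (1 - n).toNat
      (show α ≤ r + 1 by omega)
    rwa [Int.toNat_of_nonneg (by omega), sub_sub_cancel] at hne

/-- The family with initial data `x` obtained by running the recursion forwards for `n ≥ 0` and
backwards for `n < 0`. -/
noncomputable def evolveInt (x : InitVar r → K) (α : ℕ) (n : ℤ) : K :=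
  if 0 ≤ n then evolve x n.toNat α else evolve (x ∘ reverseVar) (1 - n).toNat α

theorem evolveInt_natCast (x : InitVar r → K) (α n : ℕ) : evolveInt x α n = evolve x n α := by
  simp [evolveInt]

theorem evolveInt_one_sub_natCast (x : InitVar r → K) (α n : ℕ) :
    evolveInt x α (1 - n) = evolve (x ∘ reverseVar) n α := by
  match n with
  | 0 | 1 => simp [evolveInt, evolve, reverseVar]
  | n + 2 =>
    rw [evolveInt, if_neg (by omega)]
    congr 1
    omega

theorem evolveInt_of_not_mem (x : InitVar r → K) {α : ℕ} (hα : ¬(1 ≤ α ∧ α ≤ r)) (n : ℤ) :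
    evolveInt x α n = 1 := by
  simp only [evolveInt, evolve_of_not_mem _ _ hα, ite_self]

theorem isSolution_evolveInt {x : InitVar r → K} (hx : AlgebraicIndependent ℤ x) :
    IsSolution r (evolveInt x) where
  rel α h1 hα n := by
    have hx' := hx.comp _ reverseVar_injective
    rcases le_or_gt 1 n with hn | hn
    · obtain ⟨m, rfl⟩ : ∃ m : ℕ, n = (m + 1 : ℕ) := ⟨(n - 1).toNat, by omega⟩
      rw [show ((m + 1 : ℕ) : ℤ) + 1 = (m + 2 : ℕ) by omega,
        show ((m + 1 : ℕ) : ℤ) - 1 = m by omega]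
      simp only [evolveInt_natCast]
      exact evolve_mul_evolve h1 hα (evolve_ne_zero_of_algebraicIndependent hx m α)
    · obtain ⟨m, rfl⟩ : ∃ m : ℕ, n = 1 - (m + 1 : ℕ) := ⟨(-n).toNat, by omega⟩
      rw [show 1 - ((m + 1 : ℕ) : ℤ) + 1 = 1 - m by omega,
        show 1 - ((m + 1 : ℕ) : ℤ) - 1 = 1 - (m + 2 : ℕ) by omega]
      simp only [evolveInt_one_sub_natCast]
      rw [mul_comm]
      exact evolve_mul_evolve h1 hα (evolve_ne_zero_of_algebraicIndependent hx' m α)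
  left n := evolveInt_of_not_mem x (by omega) n
  right n := evolveInt_of_not_mem x (by omega) n

theorem initialData_evolveInt (x : InitVar r → K) : initialData r (evolveInt x) = x := by
  ext v
  rw [initialData, evolveInt_natCast, evolve_initVar]

end TimeReversal

section Positivity

variable {K : Type*} [Field K] {r : ℕ} {R : ℕ → ℤ → K}

theorem algebraicIndependent_algebraMap_X (ι F : Type*) [Field F]
    [Algebra (MvPolynomial ι ℤ) F] [IsFractionRing (MvPolynomial ι ℤ) F] :
    AlgebraicIndependent ℤ fun v : ι => algebraMap (MvPolynomial ι ℤ) F (MvPolynomial.X v) :=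
  (MvPolynomial.algebraicIndependent_X ι ℤ).map'
    (f := (algebraMap (MvPolynomial ι ℤ) F).toIntAlgHom) (IsFractionRing.injective _ _)

theorem evolve_eq_eval_pathLaurent (hr : 1 ≤ r) {x : InitVar r → K}
    (hx : AlgebraicIndependent ℤ x) {α n : ℕ} (hα : α ≤ r + 1) (hn : α ≤ n + 1) :
    evolve x n α = (pathLaurent r α n).eval x := by
  have hR := isSolution_evolveInt hx
  have hinit := initialData_evolveInt x
  have h := hR.eq_eval_pathLaurent (hR.nonVanishing (hinit.symm ▸ hx)) hr hα hn
  rwa [evolveInt_natCast, hinit] at h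

theorem IsSolution.eq_eval_pathLaurent_shiftVar (hR : IsSolution r R) (hnv : NonVanishing r R)
    {n k : ℕ} (hk : n + 1 + k ≤ r) :
    R (n + 1 + k) n = (pathLaurent (r - k) (n + 1) n).eval (initialData r R ∘ shiftVar r k) := by
  have hX := algebraicIndependent_algebraMap_X (InitVar (r - k))
    (FractionRing (MvPolynomial (InitVar (r - k)) ℤ))
  have hpath := PosLaurent.eval_mem_specializations hX
    (y := initialData r R ∘ shiftVar r k) (fun v => hnv.initialData_ne_zero _)
    (pathLaurent (r - k) (n + 1) n)
  rw [← evolve_eq_eval_pathLaurent (by omega) hX (by omega) le_rfl] at hpath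
  rw [hR.eq_evolve (fun m _ α h1 hα => hnv α h1 hα m) (by omega)]
  exact snd_eq_of_mem_specializations hX
    (evolve_mem_specializations (by omega) hX (hnv.evolve_ne_zero hR) n (by omega) (by omega)) hpath

/-- The Laurent polynomial that represents `R α n`, `n ≥ 0`, in the initial data. For `α ≤ n + 1` it
is the sum over non-intersecting paths; otherwise `(α, n)` has the same light cone as `(n + 1, n)`
in the system of rank `r - k`, where `k = α - (n + 1)`. -/
noncomputable def solutionLaurentNat (r α n : ℕ) : PosLaurent (InitVar r) :=
  if α ≤ n + 1 then pathLaurent r α n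
  else Finsupp.mapDomain (pushExponent (shiftVar r (α - (n + 1))))
    (pathLaurent (r - (α - (n + 1))) (n + 1) n)

theorem IsSolution.eq_eval_solutionLaurentNat (hR : IsSolution r R) (hnv : NonVanishing r R)
    {α : ℕ} (h1 : 1 ≤ α) (hα : α ≤ r) (n : ℕ) :
    R α n = (solutionLaurentNat r α n).eval (initialData r R) := by
  unfold solutionLaurentNat
  split_ifs with h
  · exact hR.eq_eval_pathLaurent hnv (by omega) (by omega) h
  · rw [PosLaurent.eval_mapDomain_pushExponent hnv.initialData_ne_zero,
      ← hR.eq_eval_pathLaurent_shiftVar hnv (by omega), show n + 1 + (α - (n + 1)) = α by omega]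

/-- The Laurent polynomial that represents `R α n`, `n ∈ ℤ`, in the initial data. -/
noncomputable def solutionLaurent (r α : ℕ) (n : ℤ) : PosLaurent (InitVar r) :=
  if 0 ≤ n then solutionLaurentNat r α n.toNat
  else Finsupp.mapDomain (pushExponent reverseVar) (solutionLaurentNat r α (1 - n).toNat)

theorem IsSolution.eq_eval_solutionLaurent (hR : IsSolution r R) (hnv : NonVanishing r R) {α : ℕ}
    (h1 : 1 ≤ α) (hα : α ≤ r) (n : ℤ) :
    R α n = (solutionLaurent r α n).eval (initialData r R) := by
  unfold solutionLaurent
  split_ifs with h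
  · rw [← hR.eq_eval_solutionLaurentNat hnv h1 hα, Int.toNat_of_nonneg h]
  · rw [PosLaurent.eval_mapDomain_pushExponent hnv.initialData_ne_zero, ← initialData_reverse,
      ← hR.reverse.eq_eval_solutionLaurentNat hnv.reverse h1 hα, Int.toNat_of_nonneg (by omega),
      sub_sub_cancel]

theorem exists_isSolution_initialData_eq_X (r : ℕ) :
    ∃ R : ℕ → ℤ → FractionRing (MvPolynomial (InitVar r) ℤ), IsSolution r R ∧
      ∀ v, initialData r R v = algebraMap (MvPolynomial (InitVar r) ℤ) _ (MvPolynomial.X v) :=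
  have hX := algebraicIndependent_algebraMap_X (InitVar r) _
  ⟨evolveInt _, isSolution_evolveInt hX, congrFun (initialData_evolveInt _)⟩

end Positivity

end QSystem

theorem mainTheorem1 (r : ℕ) (hr : 1 ≤ r) :
    -- the solution with indeterminate initial data exists,
    (∃ R : ℕ → ℤ → FractionRing (MvPolynomial (QSystem.InitVar r) ℤ),
      QSystem.IsSolution r R ∧ ∀ v, QSystem.initialData r R v =
        algebraMap (MvPolynomial (QSystem.InitVar r) ℤ) _ (MvPolynomial.X v)) ∧
    -- solutions with algebraically independent initial data never vanish,
    (∀ (K : Type*) [Field K] (R : ℕ → ℤ → K), QSystem.IsSolution r R →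
      AlgebraicIndependent ℤ (QSystem.initialData r R) → QSystem.NonVanishing r R) ∧
    -- and every nowhere vanishing solution is given by universal expressions in its initial data
    ∃ (M : ℕ → QSystem.InitVar r → ℤ) (P : ℕ → ℤ → QSystem.PosLaurent (QSystem.InitVar r)),
      ∀ (K : Type*) [Field K] (R : ℕ → ℤ → K),
        QSystem.IsSolution r R → QSystem.NonVanishing r R →
          (∀ j : ℕ, 1 ≤ j → j ≤ 2 * r + 1 → QSystem.weight R j =
            QSystem.laurentMonomial (M j) (QSystem.initialData r R)) ∧
          (∀ α : ℕ, 1 ≤ α → α ≤ r → ∀ n : ℕ, α ≤ n + 1 →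
            R α n = R 1 0 ^ α * QSystem.pathPartition r (QSystem.weight R)
              (QSystem.startTime α) (QSystem.endTime n α)) ∧
          (∀ α : ℕ, 1 ≤ α → α ≤ r → ∀ n : ℤ,
            R α n = (P α n).eval (QSystem.initialData r R)) := by
  refine ⟨QSystem.exists_isSolution_initialData_eq_X r,
    fun K _ R hR hx => hR.nonVanishing hx,
    QSystem.weightExponent r, QSystem.solutionLaurent r, fun K _ R hR hnv => ⟨?_, ?_, ?_⟩⟩
  · exact fun j _ hj => hR.weight_eq hnv hj
  · exact fun α _ hα n hn => hR.eq_pathPartition hnv hr (by omega) hn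
  · exact fun α h1 hα n => hR.eq_eval_solutionLaurent hnv h1 hα n
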